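/- Let $G=(V,E,w)$ be a finite simple digraph (no self-loops; opposite edges are allowed) with positive edge weights. Let $d(i,j)\in[0,\infty]$ be the minimal length of a directed path from $i$ to $j$ ($\infty$ if there is none), and for $t\in\mathbb R$ let $G^t$ be the digraph on $V$ with an edge $(i,j)$ whenever $i\ne j$ and $d(i,j)\le t$. For a digraph $K$ let $\Omega_\bullet(K)$ be the regular path chain complex of $K$ with coefficients in $\mathbb R$ (allowed paths whose regular boundary is allowed). Consider two persistent vector spaces, with structure maps induced by inclusion: * the standard pipeline $\mathcal H_1(G)$, $t\mapsto H_1(\Omega_\bullet(G^t))$; * grounded persistent path homology $\mathcal H^{\mathrm{gr}}_1(G)$, which for $t\ge 0$ is the degree-one homology of $\Omega_2(G^t)\to\Omega_1(G\cup G^t)\to\Omega_0(G\cup G^t)$ and which is $0$ for $t<0$. Let $G_0=G$, and let $G_{n+1}$ be the medial subdivision of $G_n$: every edge $e=(a,b)$ is replaced by two edges $(a,m_e)$ and $(m_e,b)$ through a new vertex $m_e$, each of weight $w(e)/2$. **Theorem.** For every $n$, $\mathcal H^{\mathrm{gr}}_1(G_n)$ and $\mathcal H_1(G_n)$ have finite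 barcodes (that is, each is isomorphic to a finite direct sum of interval modules), and as $n\to\infty$ the two sequences of barcodes converge in the bottleneck distance to one and the same barcode: $$\lim_{n\to\infty}\operatorname{Barcode}\big(\mathcal H^{\mathrm{gr}}_1(G_n)\big)=\lim_{n\to\infty}\operatorname{Barcode}\big(\mathcal H_1(G_n)\big).$$ -/

import Mathlib

open CategoryTheory Filter Topology
open scoped ENNReal

namespace GrPPH

noncomputable section

/-! ### Weighted digraphs -/

/-- A weighted (simple) digraph: a finite vertex set, a set of directed edges without self-loops,
and a positive weight on every edge (the values of `w` at pairs that are not edges play no role). -/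
structure WDigraph where
  /-- The vertex set. -/
  V : Type
  [finV : Finite V]
  /-- The underlying digraph. -/
  graph : Digraph V
  loopless : ∀ a, ¬ graph.Adj a a
  /-- The edge weights. -/
  w : V → V → ℝ
  w_pos : ∀ a b, graph.Adj a b → 0 < w a b

attribute [instance] WDigraph.finV

namespace WDigraph

variable (G : WDigraph)

/-- The list `l` of vertices is a directed path (no repeated vertices) from `a` to `b` in `G`.
The one-vertex list is the path with no edges from a vertex to itself. -/
def IsPath (a b : G.V) (l : List G.V) : Prop :=
  l.IsChain G.graph.Adj ∧ l.Nodup ∧ l.head? = some a ∧ l.getLast? = some b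

/-- The length of a path, i.e. the sum of the weights of its edges. -/
def pathLength : List G.V → ℝ
  | [] => 0
  | [_] => 0
  | a :: b :: l => G.w a b + pathLength (b :: l)

/-- The shortest-path quasimetric, with value `⊤` if there is no path. -/
def dist (a b : G.V) : EReal :=
  ⨅ (l : List G.V) (_ : G.IsPath a b l), (G.pathLength l : EReal)

/-- The digraph `G^t` of the shortest-path filtration. -/
def shortestPath (t : ℝ) : Digraph G.V where
  Adj a b := a ≠ b ∧ G.dist a b ≤ (t : EReal)

/-- The digraph in which the one-chains of the grounded complex live: it is `G ∪ G^t` for `t ≥ 0`.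
The grounded filtration starts at time `0`: there are no edges at negative times. -/
def grounded (t : ℝ) : Digraph G.V where
  Adj a b := (0 ≤ t ∧ G.graph.Adj a b) ∨ (G.shortestPath t).Adj a b

theorem shortestPath_mono : Monotone G.shortestPath := fun _ _ hst _ _ h =>
  ⟨h.1, h.2.trans (EReal.coe_le_coe_iff.2 hst)⟩

theorem grounded_mono : Monotone G.grounded := fun _ _ hst _ _ h =>
  h.imp (fun h' => ⟨h'.1.trans hst, h'.2⟩) (fun h' => G.shortestPath_mono hst h')

/-- The medial subdivision: every edge `e = (a, b)` is replaced by two edges `(a, m_e)`, `(m_e, b)`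
through a new vertex `m_e`, each of weight `w e / 2`. -/
def medial : WDigraph where
  V := G.V ⊕ {e : G.V × G.V // G.graph.Adj e.1 e.2}
  graph :=
    { Adj := fun x y => match x, y with
        | Sum.inl a, Sum.inr e => a = e.1.1
        | Sum.inr e, Sum.inl b => b = e.1.2
        | _, _ => False }
  loopless := by rintro (a | e) h <;> exact h
  w := fun x y => match x, y with
    | Sum.inl _, Sum.inr e => G.w e.1.1 e.1.2 / 2
    | Sum.inr e, Sum.inl _ => G.w e.1.1 e.1.2 / 2
    | _, _ => 0
  w_pos := by
    rintro (a | e) (b | e') h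
    · exact h.elim
    · exact half_pos (G.w_pos _ _ e'.2)
    · exact half_pos (G.w_pos _ _ e.2)
    · exact h.elim

/-- The `n`-th iterated medial subdivision. -/
def iteratedMedial : ℕ → WDigraph
  | 0 => G
  | n + 1 => (iteratedMedial n).medial

end WDigraph

/-! ### The regular path complex, over `ℝ` -/

section PathComplex

variable {V : Type}

/-- The space `Λ_p` of real combinations of elementary `p`-paths `v_0 … v_p` on `V`. -/
abbrev Chains (V : Type) (p : ℕ) : Type := (Fin (p + 1) → V) →₀ ℝ

/-- An elementary path is regular if consecutive vertices are distinct. -/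
def IsRegular {p : ℕ} (v : Fin (p + 1) → V) : Prop :=
  ∀ i : Fin p, v i.castSucc ≠ v i.succ

/-- An elementary path is allowed if consecutive vertices are joined by an edge. -/
def IsAllowed (K : Digraph V) {p : ℕ} (v : Fin (p + 1) → V) : Prop :=
  ∀ i : Fin p, K.Adj (v i.castSucc) (v i.succ)

open scoped Classical in
/-- The regular boundary map: the alternating sum of the faces, non-regular faces being `0`. -/
def boundary (V : Type) (p : ℕ) : Chains V (p + 1) →ₗ[ℝ] Chains V p :=
  Finsupp.linearCombination ℝ fun v : Fin (p + 2) → V =>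
    ∑ i : Fin (p + 2), (-1 : ℝ) ^ (i : ℕ) •
      (if IsRegular (v ∘ i.succAbove) then Finsupp.single (v ∘ i.succAbove) (1 : ℝ) else 0)

/-- The space `A_p` spanned by the allowed `p`-paths. -/
def allowed (K : Digraph V) (p : ℕ) : Submodule ℝ (Chains V p) :=
  Finsupp.supported ℝ ℝ {v | IsAllowed K v}

/-- The space `Ω_p` of `∂`-invariant `p`-paths: allowed chains whose boundary is allowed. -/
def invariantPaths (K : Digraph V) : (p : ℕ) → Submodule ℝ (Chains V p)
  | 0 => allowed K 0
  | p + 1 => allowed K (p + 1) ⊓ (allowed K p).comap (boundary V p)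

theorem allowed_mono {K L : Digraph V} (h : K ≤ L) (p : ℕ) : allowed K p ≤ allowed L p :=
  Finsupp.supported_mono fun _ hv i => h (hv i)

theorem invariantPaths_mono {K L : Digraph V} (h : K ≤ L) :
    ∀ p : ℕ, invariantPaths K p ≤ invariantPaths L p
  | 0 => allowed_mono h 0
  | p + 1 => inf_le_inf (allowed_mono h _) (Submodule.comap_mono (allowed_mono h _))

/-- The one-cycles `ker (∂ : Ω_1 L → Ω_0 L)`. -/
def cycles (L : Digraph V) : Submodule ℝ (Chains V 1) :=
  invariantPaths L 1 ⊓ LinearMap.ker (boundary V 0)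

/-- The one-boundaries `im (∂ : Ω_2 K → Λ_1)`. -/
def boundaries (K : Digraph V) : Submodule ℝ (Chains V 1) :=
  (invariantPaths K 2).map (boundary V 1)

theorem cycles_mono {K L : Digraph V} (h : K ≤ L) : cycles K ≤ cycles L :=
  inf_le_inf_right _ (invariantPaths_mono h 1)

theorem boundaries_mono {K L : Digraph V} (h : K ≤ L) : boundaries K ≤ boundaries L :=
  Submodule.map_mono (invariantPaths_mono h 2)

end PathComplex

/-! ### Persistent vector spaces -/

/-- Persistent (real) vector spaces: functors from the poset `(ℝ, ≤)`. -/
abbrev PersVec := ℝ ⥤ ModuleCat.{0} ℝ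

/-- The persistent vector space `t ↦ Z t / (B t ∩ Z t)` of two increasing families of subspaces, with
the maps induced by the inclusions. -/
def subquotient {M : Type} [AddCommGroup M] [Module ℝ M] (Z B : ℝ → Submodule ℝ M)
    (hZ : Monotone Z) (hB : Monotone B) : PersVec where
  obj t := ModuleCat.of ℝ (Z t ⧸ (B t).submoduleOf (Z t))
  map {s t} f := ModuleCat.ofHom
    (Submodule.mapQ ((B s).submoduleOf (Z s)) ((B t).submoduleOf (Z t))
      (Submodule.inclusion (hZ (leOfHom f))) fun _ hx => hB (leOfHom f) hx)
  map_id t := by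
    ext x
    rfl
  map_comp f g := by
    ext x
    rfl

/-- For filtrations `K t ⊆ L t` of digraphs, the degree one homology (cycles modulo boundaries) of
the complexes `Ω_2 (K t) → Ω_1 (L t) → Ω_0 (L t)`, with the maps induced by the inclusions. -/
def persistentH1 {V : Type} (K L : ℝ → Digraph V) (hK : Monotone K) (hL : Monotone L) :
    PersVec :=
  subquotient (fun t => cycles (L t)) (fun t => boundaries (K t))
    (fun _ _ h => cycles_mono (hL h)) (fun _ _ h => boundaries_mono (hK h))

/-- The standard pipeline in degree one: persistent regular path homology of the shortest-path
filtration. -/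
def standardPH (G : WDigraph) : PersVec :=
  persistentH1 G.shortestPath G.shortestPath G.shortestPath_mono G.shortestPath_mono

/-- Grounded persistent path homology: the degree one homology of
`Ω_2 (G^t) → Ω_1 (G ∪ G^t) → Ω_0 (G ∪ G^t)`. -/
def groundedPH (G : WDigraph) : PersVec :=
  persistentH1 G.shortestPath G.grounded G.shortestPath_mono G.grounded_mono

/-! ### Barcodes -/

/-- A nonempty interval of `ℝ` of any kind: open, closed or half-open, bounded or not. -/
structure RInterval where
  /-- The underlying set. -/
  carrier : Set ℝ
  nonempty : carrier.Nonempty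
  ordConnected : carrier.OrdConnected

/-- The value at `t` of the interval module of `I`: all of `ℝ` if `t ∈ I`, and `0` otherwise. -/
def RInterval.fiber (I : RInterval) (t : ℝ) : Submodule ℝ ℝ where
  carrier := {x | t ∉ I.carrier → x = 0}
  zero_mem' := fun _ => rfl
  add_mem' := fun hx hy ht => by rw [hx ht, hy ht, add_zero]
  smul_mem' := fun c x hx ht => by rw [hx ht, smul_zero]

open scoped Classical in
/-- The transition map of the interval module: the identity if `s, t ∈ I`, and `0` otherwise
(the source is `0` if `s ∉ I`). -/
def RInterval.fiberMap (I : RInterval) (s t : ℝ) : I.fiber s →ₗ[ℝ] I.fiber t where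
  toFun x := ⟨if t ∈ I.carrier then x.1 else 0, fun ht => if_neg ht⟩
  map_add' x y := by
    ext
    by_cases ht : t ∈ I.carrier <;> simp [ht]
  map_smul' c x := by
    ext
    by_cases ht : t ∈ I.carrier <;> simp [ht]

/-- The interval module `P(I)`. -/
def intervalModule (I : RInterval) : PersVec where
  obj t := ModuleCat.of ℝ (I.fiber t)
  map {s t} _ := ModuleCat.ofHom (I.fiberMap s t)
  map_id t := by
    ext x
    by_cases ht : t ∈ I.carrier
    · simp [RInterval.fiberMap, ht]
    · simp [RInterval.fiberMap, ht, x.2 ht]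
  map_comp {r s t} f g := by
    ext x
    by_cases ht : t ∈ I.carrier
    · by_cases hs : s ∈ I.carrier
      · simp [RInterval.fiberMap, ht, hs]
      · have hr : r ∉ I.carrier := fun hr =>
          hs (I.ordConnected.out hr ht ⟨leOfHom f, leOfHom g⟩)
        simp [RInterval.fiberMap, ht, hs, x.2 hr]
    · simp [RInterval.fiberMap, ht]

/-- The direct sum of a finite family of persistent vector spaces, formed pointwise. -/
def directSum {ι : Type} [Finite ι] (N : ι → PersVec) : PersVec where
  obj t := ModuleCat.of ℝ (∀ i, (N i).obj t)
  map f := ModuleCat.ofHom (LinearMap.pi fun i => ((N i).map f).hom ∘ₗ LinearMap.proj i)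
  map_id t := by
    ext x i
    simp
  map_comp f g := by
    ext x i
    simp

/-- A barcode: a finite multiset of intervals, written as a finite family. -/
structure Barcode where
  /-- The index set of the features. -/
  ι : Type
  [finι : Finite ι]
  /-- The interval of a feature. -/
  bar : ι → RInterval

attribute [instance] Barcode.finι

/-- `B` is the barcode of `M`: `M` is isomorphic to the direct sum of the interval modules of the
intervals in `B`. -/
def IsBarcode (M : PersVec) (B : Barcode) : Prop :=
  Nonempty (M ≅ directSum fun i => intervalModule (B.bar i))

/-- The birth time, i.e. the left endpoint. -/
def RInterval.birth (I : RInterval) : EReal := sInf ((fun x : ℝ => (x : EReal)) '' I.carrier)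

/-- The death time, i.e. the right endpoint. -/
def RInterval.death (I : RInterval) : EReal := sSup ((fun x : ℝ => (x : EReal)) '' I.carrier)

open scoped Classical in
/-- The distance of two extended real numbers: `|x - y|` if both are real, and otherwise `0` if
`x = y` and `∞` if not. -/
def extDist (x y : EReal) : ℝ≥0∞ := if x = y then 0 else (x - y).abs

/-- The distance in the sup norm of the points of two intervals in the persistence diagram. -/
def RInterval.pointDist (I J : RInterval) : ℝ≥0∞ :=
  max (extDist I.birth J.birth) (extDist I.death J.death)

/-- The distance in the sup norm of the point of an interval in the persistence diagram to the
diagonal. -/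
def RInterval.diagDist (I : RInterval) : ℝ≥0∞ :=
  ⨅ x : ℝ, max (extDist I.birth x) (extDist I.death x)

/-- The cost of a partial matching of two barcodes: the largest distance between matched points,
or of an unmatched point to the diagonal. -/
def matchingCost (B C : Barcode) (σ : B.ι ≃. C.ι) : ℝ≥0∞ :=
  (⨆ (i : B.ι) (j : C.ι) (_ : σ i = some j), (B.bar i).pointDist (C.bar j)) ⊔
    ((⨆ (i : B.ι) (_ : σ i = none), (B.bar i).diagDist) ⊔
      (⨆ (j : C.ι) (_ : σ.symm j = none), (C.bar j).diagDist))

/-- The bottleneck distance: the infimum of the costs of all partial matchings, unmatched points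
being matched to the diagonal. -/
def bottleneckDist (B C : Barcode) : ℝ≥0∞ := ⨅ σ : B.ι ≃. C.ι, matchingCost B C σ

/-- The persistent vector spaces `M 0, M 1, …` all have a barcode, and their barcodes converge to
the barcode `L` in the bottleneck distance. -/
def BarcodesTendsto (M : ℕ → PersVec) (L : Barcode) : Prop :=
  (∀ n, ∃ B, IsBarcode (M n) B) ∧
    ∀ B : ℕ → Barcode, (∀ n, IsBarcode (M n) (B n)) →
      Tendsto (fun n => bottleneckDist (B n) L) atTop (𝓝 0)

end

end GrPPH

/-!
Two chains of subspaces of a finite-dimensional space have a common adapted basis; applied to the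
cycles and the boundaries, this gives both pipelines finite barcodes.

Let `m` be the largest edge weight of `G`. For `t ≥ m` the digraph `G^t` contains `G`, and splitting
an edge `(a, b)` of `G^t` along a walk of length at most `t` into triangles of `G^t` shows that
every cycle of `G^t` is homologous to a cycle of `G`. So from time `m` on both pipelines have the
same Betti curve, the rank of the cycles of `G` in the homology of `G^t`, and their transition maps
are surjective. All bars are therefore born in `[0, m]`, and the barcode is determined up to an
error `m` by its Betti curve: match the bars alive at time `m` in the order of their deaths.

Subdividing the edges and collapsing every midpoint to an endpoint identify the cycles of `G` with
those of its medial subdivision, and both maps preserve boundaries up to a delay `m`, so the Betti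
curves of `G` and of its subdivision are `m`-interleaved. As `m` is halved by each subdivision, the
delays form a convergent geometric series and the Betti curves converge.
-/

namespace GrPPH

noncomputable section

/-! ### Interleaved functions -/

section Interleaved

variable {α : Type*} [Preorder α]

/-- `f` and `g` are `δ`-interleaved: each is bounded by the other with its argument delayed by `δ`.
This is the shadow on Betti curves of a `δ`-interleaving of persistent vector spaces. -/
def Interleaved (δ : ℝ) (f g : ℝ → α) : Prop :=
  ∀ t, f (t + δ) ≤ g t ∧ g (t + δ) ≤ f t

variable {f g h : ℝ → α} {δ ε : ℝ}

theorem Interleaved.refl (f : ℝ → α) : Interleaved 0 f f := fun t => by simp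

theorem Interleaved.trans (hfg : Interleaved δ f g) (hgh : Interleaved ε g h) :
    Interleaved (δ + ε) f h := fun t =>
  ⟨by simpa only [add_assoc, add_comm ε] using (hfg (t + ε)).1.trans (hgh t).1,
    by simpa only [add_assoc] using (hgh (t + δ)).2.trans (hfg t).2⟩

theorem Interleaved.mono (hfg : Interleaved δ f g) (hf : Antitone f) (hg : Antitone g)
    (hδε : δ ≤ ε) : Interleaved ε f g := fun t =>
  ⟨(hf (by gcongr)).trans (hfg t).1, (hg (by gcongr)).trans (hfg t).2⟩

theorem exists_antitone_interleaved {α : Type*} [ConditionallyCompleteLinearOrderBot α]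
    {f : ℕ → ℝ → α} {δ : ℕ → ℝ} (hf : ∀ n, Antitone (f n)) (hδ : ∀ n, 0 ≤ δ n)
    (hff : ∀ n, Interleaved (δ n - δ (n + 1)) (f n) (f (n + 1))) :
    ∃ g, Antitone g ∧ ∀ n, Interleaved (δ n) (f n) g := by
  have pairs {m n : ℕ} (hmn : m ≤ n) : Interleaved (δ m - δ n) (f m) (f n) := by
    induction n, hmn using Nat.le_induction with
    | base => simpa only [sub_self] using Interleaved.refl (f m)
    | succ n _ ih => simpa only [sub_add_sub_cancel] using ih.trans (hff n)
  refine ⟨fun t => ⨅ n, f n (t - δ n),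
    fun s t hst => le_ciInf fun n => (ciInf_le' _ n).trans (hf n (by gcongr)),
    fun n t => ⟨le_ciInf fun m => ?_, ?_⟩⟩
  · rcases le_total n m with hnm | hmn
    · calc f n (t + δ n) = f n (t - δ m + (δ n - δ m) + 2 * δ m) := by ring_nf
        _ ≤ f n (t - δ m + (δ n - δ m)) := hf n (by linarith [hδ m])
        _ ≤ f m (t - δ m) := (pairs hnm (t - δ m)).1
    · calc f n (t + δ n) ≤ f n (t - δ m + (δ m - δ n)) := hf n (by linarith [hδ n])
        _ ≤ f m (t - δ m) := (pairs hmn (t - δ m)).2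
  · simpa only [add_sub_cancel_right] using ciInf_le' (fun m => f m (t + δ n - δ m)) n

end Interleaved
/-! ### Bases adapted to two chains of subspaces -/

section Lattice

variable {α : Type*} [Lattice α] [OrderBot α] [WellFoundedGT α]

theorem exists_covBy_of_isChain {𝒞 : Set α} (h𝒞 : IsChain (· ≤ ·) 𝒞) {w : α} (hw : w ≠ ⊥) :
    ∃ h, h ⋖ w ∧ ∀ x ∈ 𝒞, w ≤ x ∨ x ⊓ w ≤ h := by
  have hchain : IsChain (· ≤ ·) (insert ⊥ 𝒞) := h𝒞.insert fun _ _ _ => Or.inl bot_le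
  obtain ⟨m, ⟨hm𝒞, hwm⟩, hmax⟩ := WellFounded.has_min (wellFounded_gt (α := α))
    {x ∈ insert ⊥ 𝒞 | ¬ w ≤ x} ⟨⊥, Set.mem_insert _ _, fun h => hw (le_bot_iff.1 h)⟩
  obtain ⟨h, hmh, hhw⟩ := exists_le_covBy_of_lt (inf_lt_right.2 hwm)
  refine ⟨h, hhw, fun x hx => or_iff_not_imp_left.2 fun hwx => ?_⟩
  have hxm : x ≤ m := by
    rcases hchain.total (Set.mem_insert_of_mem _ hx) hm𝒞 with hxm | hmx
    · exact hxm
    · exact (eq_of_le_of_not_lt hmx (hmax x ⟨Set.mem_insert_of_mem _ hx, hwx⟩)).ge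
  exact (inf_le_inf_right w hxm).trans hmh

end Lattice

section AdaptedBasis

variable {k E : Type*} [DivisionRing k] [AddCommGroup E] [Module k E]

/-- A basis is adapted to a subspace if every vector of the subspace is a combination of basis
vectors that lie in the subspace. -/
def IsAdapted {ι : Type*} (b : Module.Basis ι k E) (X : Submodule k E) : Prop :=
  ∀ x ∈ X, ∀ i, b.repr x i ≠ 0 → b i ∈ X

theorem IsAdapted.mem_iff {ι : Type*} {b : Module.Basis ι k E} {X : Submodule k E}
    (hb : IsAdapted b X) {x : E} : x ∈ X ↔ ∀ i, b.repr x i ≠ 0 → b i ∈ X := by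
  refine ⟨hb x, fun h => ?_⟩
  rw [← b.linearCombination_repr x]
  exact Submodule.sum_mem _ fun i hi => X.smul_mem _ (h i (Finsupp.mem_support_iff.1 hi))

variable [FiniteDimensional k E]

theorem exists_mem_diff_of_isChain {ℬ : Set (Submodule k E)} (hℬ : IsChain (· ≤ ·) ℬ)
    {H W : Submodule k E} (hHW : H < W) :
    ∃ v ∈ W, v ∉ H ∧ ∀ X ∈ ℬ, X ⊓ W ≤ H ∨ v ∈ X := by
  have hchain : IsChain (· ≤ ·) (insert ⊤ ℬ) := hℬ.insert fun _ _ _ => Or.inr le_top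
  obtain ⟨M, ⟨hMℬ, hM⟩, hmin⟩ := WellFounded.has_min (wellFounded_lt (α := Submodule k E))
    {X ∈ insert ⊤ ℬ | ¬ X ⊓ W ≤ H}
    ⟨⊤, Set.mem_insert _ _, by simpa only [top_inf_eq] using hHW.not_ge⟩
  obtain ⟨v, ⟨hvM, hvW⟩, hvH⟩ := SetLike.not_le_iff_exists.1 hM
  refine ⟨v, hvW, hvH, fun X hX => or_iff_not_imp_left.2 fun hXH => ?_⟩
  rcases hchain.total (Set.mem_insert_of_mem _ hX) hMℬ with hXM | hMX
  · exact (eq_of_le_of_not_lt hXM (hmin X ⟨Set.mem_insert_of_mem _ hX, hXH⟩)).ge hvM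
  · exact hMX hvM

theorem exists_covBy_mem_diff {𝒵 ℬ : Set (Submodule k E)} (h𝒵 : IsChain (· ≤ ·) 𝒵)
    (hℬ : IsChain (· ≤ ·) ℬ) {W : Submodule k E} (hW : W ≠ ⊥) :
    ∃ H, H ⋖ W ∧ ∃ v ∈ W, v ∉ H ∧ ∀ X ∈ 𝒵 ∪ ℬ, X ⊓ W ≤ H ∨ v ∈ X := by
  obtain ⟨H, hHW, hH⟩ := exists_covBy_of_isChain h𝒵 hW
  obtain ⟨v, hvW, hvH, hv⟩ := exists_mem_diff_of_isChain hℬ hHW.lt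
  exact ⟨H, hHW, v, hvW, hvH, fun X hX =>
    hX.elim (fun h => (hH X h).symm.imp_right fun hWX => hWX hvW) (hv X)⟩

theorem exists_linearIndepOn_span_inter {𝒵 ℬ : Set (Submodule k E)} (h𝒵 : IsChain (· ≤ ·) 𝒵)
    (hℬ : IsChain (· ≤ ·) ℬ) (W : Submodule k E) :
    ∃ S : Set E, LinearIndepOn k id S ∧ Submodule.span k S = W ∧
      ∀ X ∈ 𝒵 ∪ ℬ, X ⊓ W ≤ Submodule.span k (S ∩ X) := by
  induction W using WellFoundedLT.induction with
  | ind W ih =>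
  rcases eq_or_ne W ⊥ with rfl | hW
  · exact ⟨∅, linearIndepOn_empty k id, by simp, by simp⟩
  obtain ⟨H, hHW, v, hvW, hvH, hX⟩ := exists_covBy_mem_diff h𝒵 hℬ hW
  obtain ⟨S, hS, hSH, hSX⟩ := ih H hHW.lt
  have hspan : Submodule.span k {v} ⊔ H = W := by
    refine (hHW.eq_or_eq le_sup_right (sup_le ?_ hHW.le)).resolve_left fun h => hvH ?_
    · rwa [Submodule.span_singleton_le_iff_mem]
    · rwa [sup_eq_right, Submodule.span_singleton_le_iff_mem] at h
  refine ⟨insert v S, hS.insert (by simpa [hSH] using hvH),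
    by rw [Submodule.span_insert, hSH, hspan], fun X hXmem => ?_⟩
  rcases hX X hXmem with hXH | hvX
  · calc X ⊓ W ≤ X ⊓ H := le_inf inf_le_left hXH
      _ ≤ Submodule.span k (S ∩ X) := hSX X hXmem
      _ ≤ Submodule.span k (insert v S ∩ X) :=
        Submodule.span_mono (Set.inter_subset_inter_left _ (Set.subset_insert v S))
  · rw [← Submodule.span_singleton_le_iff_mem] at hvX
    calc X ⊓ W = Submodule.span k {v} ⊔ X ⊓ H := by
          rw [← hspan, inf_comm, sup_inf_assoc_of_le _ hvX, inf_comm]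
      _ ≤ Submodule.span k {v} ⊔ Submodule.span k (S ∩ X) := sup_le_sup_left (hSX X hXmem) _
      _ = Submodule.span k (insert v S ∩ X) := by
          rw [Set.insert_inter_of_mem (hvX (Submodule.mem_span_singleton_self v)),
            Submodule.span_insert]

theorem exists_basis_isAdapted {𝒵 ℬ : Set (Submodule k E)} (h𝒵 : IsChain (· ≤ ·) 𝒵)
    (hℬ : IsChain (· ≤ ·) ℬ) :
    ∃ (S : Set E) (b : Module.Basis S k E), ∀ X ∈ 𝒵 ∪ ℬ, IsAdapted b X := by
  obtain ⟨S, hS, hspan, hSX⟩ := exists_linearIndepOn_span_inter h𝒵 hℬ ⊤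
  refine ⟨S, Module.Basis.mk hS (by simp [hspan]), fun X hX x hx i hi => ?_⟩
  have himage : S ∩ X = Module.Basis.mk hS (by simp [hspan]) '' {i : S | (i : E) ∈ X} := by
    ext y
    simp [and_comm]
  have hx' := hSX X hX ⟨hx, Submodule.mem_top⟩
  rw [himage, Module.Basis.mem_span_image] at hx'
  simpa using hx' (Finsupp.mem_support_iff.2 hi)

end AdaptedBasis
/-! ### The barcode of a subquotient -/

theorem RInterval.coe_fiber_eq_zero (I : RInterval) {t : ℝ} (ht : t ∉ I.carrier) (x : I.fiber t) :
    (x : ℝ) = 0 := x.2 ht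

open scoped Classical in
/-- The canonical projection of `ℝ` onto the fiber at `t` of the interval module of `I`. -/
def RInterval.truncate (I : RInterval) (t : ℝ) : ℝ →ₗ[ℝ] I.fiber t where
  toFun x := ⟨if t ∈ I.carrier then x else 0, fun ht => if_neg ht⟩
  map_add' x y := by
    ext
    by_cases ht : t ∈ I.carrier <;> simp [ht]
  map_smul' c x := by
    ext
    by_cases ht : t ∈ I.carrier <;> simp [ht]

theorem RInterval.truncate_of_mem (I : RInterval) {t : ℝ} (ht : t ∈ I.carrier) (x : ℝ) :
    (I.truncate t x : ℝ) = x := if_pos ht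

theorem RInterval.fiberMap_truncate (I : RInterval) {s t : ℝ} {x : ℝ}
    (h : t ∈ I.carrier → s ∉ I.carrier → x = 0) :
    I.fiberMap s t (I.truncate s x) = I.truncate t x := by
  ext
  by_cases ht : t ∈ I.carrier <;> by_cases hs : s ∈ I.carrier <;>
    simp [RInterval.fiberMap, RInterval.truncate, ht, hs, h]

section Subquotient

variable {E : Type} [AddCommGroup E] [Module ℝ E] {Z B : ℝ → Submodule ℝ E}

theorem nonempty_subquotient_iso (hZ : Monotone Z) (hB : Monotone B) {N : PersVec}
    (φ : ∀ t, Z t →ₗ[ℝ] N.obj t) (hsurj : ∀ t, Function.Surjective (φ t))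
    (hker : ∀ t, LinearMap.ker (φ t) = (B t).submoduleOf (Z t))
    (hnat : ∀ {s t : ℝ} (f : s ⟶ t) (z : Z s),
      φ t (Submodule.inclusion (hZ (leOfHom f)) z) = (N.map f).hom (φ s z)) :
    Nonempty (subquotient Z B hZ hB ≅ N) := by
  let e (t : ℝ) : (Z t ⧸ (B t).submoduleOf (Z t)) ≃ₗ[ℝ] N.obj t :=
    (Submodule.quotEquivOfEq _ _ (hker t).symm).trans
      ((φ t).quotKerEquivOfSurjective (hsurj t))
  refine ⟨NatIso.ofComponents (fun t => (e t).toModuleIso) fun {s t} f => ?_⟩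
  ext x
  obtain ⟨z, rfl⟩ := Submodule.Quotient.mk_surjective _ x
  exact hnat f z

variable {ι : Type} [Finite ι]

/-- The barcode of the subquotient `Z t / (B t ∩ Z t)`, read off a basis adapted to all the `Z t`
and all the `B t`: a basis vector is alive while it lies in `Z t` and not in `B t`. -/
def subquotientBarcode (hZ : Monotone Z) (hB : Monotone B) (b : Module.Basis ι ℝ E) : Barcode where
  ι := {i // {t | b i ∈ Z t ∧ b i ∉ B t}.Nonempty}
  bar i :=
    { carrier := {t | b i ∈ Z t ∧ b i ∉ B t}
      nonempty := i.2
      ordConnected := ⟨fun _ hs _ ht _ hu => ⟨hZ hu.1 hs.1, fun h => ht.2 (hB hu.2 h)⟩⟩ }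

variable (hZ : Monotone Z) (hB : Monotone B) (b : Module.Basis ι ℝ E)

/-- The coordinates of a vector of `Z t` along the basis vectors that are alive at time `t`. -/
def aliveCoordinates (t : ℝ) :
    Z t →ₗ[ℝ] ∀ i, ((subquotientBarcode hZ hB b).bar i).fiber t :=
  LinearMap.pi fun i =>
    ((subquotientBarcode hZ hB b).bar i).truncate t ∘ₗ b.coord i.1 ∘ₗ (Z t).subtype

variable {b}

theorem ker_aliveCoordinates {t : ℝ} (hbZ : IsAdapted b (Z t)) (hbB : IsAdapted b (B t)) :
    LinearMap.ker (aliveCoordinates hZ hB b t) = (B t).submoduleOf (Z t) := by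
  ext z
  rw [LinearMap.mem_ker, Submodule.submoduleOf, Submodule.mem_comap, Submodule.subtype_apply,
    hbB.mem_iff]
  refine ⟨fun hz i hi => ?_, fun hz => ?_⟩
  · by_contra hiB
    have alive : b i ∈ Z t ∧ b i ∉ B t := ⟨hbZ z z.2 i hi, hiB⟩
    have hzi := congrArg Subtype.val (congrFun hz ⟨i, t, alive⟩)
    exact hi ((RInterval.truncate_of_mem _ alive _).symm.trans hzi)
  · ext i
    by_cases alive : b i.1 ∈ Z t ∧ b i.1 ∉ B t
    · exact (RInterval.truncate_of_mem _ alive _).trans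
        (not_not.1 fun hi => alive.2 (hz i.1 hi))
    · exact RInterval.coe_fiber_eq_zero _ alive _

theorem aliveCoordinates_surjective {t : ℝ} (hbZ : IsAdapted b (Z t)) :
    Function.Surjective (aliveCoordinates hZ hB b t) := by
  classical
  have := Fintype.ofFinite ι
  intro y
  let x : E := b.equivFun.symm fun i =>
    if h : {t | b i ∈ Z t ∧ b i ∉ B t}.Nonempty then y ⟨i, h⟩ else 0
  have hx (i : ι) : b.repr x i =
      if h : {t | b i ∈ Z t ∧ b i ∉ B t}.Nonempty then (y ⟨i, h⟩ : ℝ) else 0 := by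
    rw [← b.equivFun_apply, LinearEquiv.apply_symm_apply]
  have hxZ : x ∈ Z t := hbZ.mem_iff.2 fun i hi => by
    by_contra hiZ
    refine hi ?_
    rw [hx]
    split_ifs with h
    · exact RInterval.coe_fiber_eq_zero _ (fun alive : b i ∈ Z t ∧ b i ∉ B t => hiZ alive.1) _
    · rfl
  refine ⟨⟨x, hxZ⟩, funext fun i => Subtype.ext ?_⟩
  by_cases alive : b i.1 ∈ Z t ∧ b i.1 ∉ B t
  · exact (RInterval.truncate_of_mem _ alive _).trans ((hx i.1).trans (dif_pos i.2))
  · rw [RInterval.coe_fiber_eq_zero _ alive, RInterval.coe_fiber_eq_zero _ alive]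

theorem isBarcode_subquotientBarcode (hbZ : ∀ t, IsAdapted b (Z t))
    (hbB : ∀ t, IsAdapted b (B t)) :
    IsBarcode (subquotient Z B hZ hB) (subquotientBarcode hZ hB b) := by
  refine nonempty_subquotient_iso hZ hB (aliveCoordinates hZ hB b)
    (fun t => aliveCoordinates_surjective hZ hB (hbZ t))
    (fun t => ker_aliveCoordinates hZ hB (hbZ t) (hbB t)) fun {s t} f z => funext fun i => ?_
  refine (RInterval.fiberMap_truncate _ fun ht hs => ?_).symm
  by_contra hzi
  exact hs ⟨hbZ s z z.2 i.1 hzi, fun hiB => ht.2 (hB (leOfHom f) hiB)⟩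

theorem exists_isBarcode_subquotient [FiniteDimensional ℝ E] :
    ∃ C, IsBarcode (subquotient Z B hZ hB) C := by
  obtain ⟨S, b, hb⟩ := exists_basis_isAdapted hZ.isChain_range hB.isChain_range
  have : Finite S := Module.Finite.finite_basis b
  exact ⟨_, isBarcode_subquotientBarcode hZ hB (fun t => hb _ (Or.inl ⟨t, rfl⟩))
    fun t => hb _ (Or.inr ⟨t, rfl⟩)⟩

end Subquotient
/-! ### Bottleneck distance and Betti curves -/

theorem extDist_le {x y : EReal} {c : ℝ} (hx : x ≠ ⊥) (hy : y ≠ ⊥) (hxy : x ≤ y + c)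
    (hyx : y ≤ x + c) : extDist x y ≤ ENNReal.ofReal c := by
  unfold extDist
  split_ifs with h
  · exact zero_le
  have lt_top {z : ℝ} : (z : EReal) + c < ⊤ := EReal.coe_add z c ▸ EReal.coe_lt_top _
  cases x with
  | bot => exact absurd rfl hx
  | top =>
    cases y with
    | bot => exact absurd rfl hy
    | top => exact absurd rfl h
    | coe y => exact absurd hxy lt_top.not_ge
  | coe x =>
    cases y with
    | bot => exact absurd rfl hy
    | top => exact absurd hyx lt_top.not_ge
    | coe y =>
      rw [← EReal.coe_add, EReal.coe_le_coe_iff] at hxy hyx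
      rw [← EReal.coe_sub, EReal.abs_def]
      exact ENNReal.ofReal_le_ofReal (abs_sub_le_iff.2 ⟨by linarith, by linarith⟩)

theorem extDist_le_of_mem_Icc {x y : EReal} {a b : ℝ} (hx : x ∈ Set.Icc (a : EReal) b)
    (hy : y ∈ Set.Icc (a : EReal) b) : extDist x y ≤ ENNReal.ofReal (b - a) := by
  have hab : (b : EReal) = a + (b - a : ℝ) := by
    rw [← EReal.coe_add, add_sub_cancel]
  exact extDist_le ((EReal.bot_lt_coe a).trans_le hx.1).ne' ((EReal.bot_lt_coe a).trans_le hy.1).ne'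
    (hx.2.trans (hab.le.trans (add_le_add_left hy.1 _)))
    (hy.2.trans (hab.le.trans (add_le_add_left hx.1 _)))

namespace RInterval

variable (I : RInterval) {a b t : ℝ}

theorem birth_le (ht : t ∈ I.carrier) : I.birth ≤ t := sInf_le ⟨t, ht, rfl⟩

theorem le_death (ht : t ∈ I.carrier) : (t : EReal) ≤ I.death := le_sSup ⟨t, ht, rfl⟩

theorem le_birth (h : ∀ t ∈ I.carrier, a ≤ t) : (a : EReal) ≤ I.birth :=
  le_sInf (Set.forall_mem_image.2 fun t ht => EReal.coe_le_coe_iff.2 (h t ht))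

theorem death_le (h : ∀ t ∈ I.carrier, t ≤ b) : I.death ≤ b :=
  sSup_le (Set.forall_mem_image.2 fun t ht => EReal.coe_le_coe_iff.2 (h t ht))

theorem mem_of_lt_death {s : ℝ} (hs : s ∈ I.carrier) (hst : s ≤ t) (ht : (t : EReal) < I.death) :
    t ∈ I.carrier := by
  obtain ⟨_, ⟨u, hu, rfl⟩, htu⟩ := lt_sSup_iff.1 ht
  exact I.ordConnected.out hs hu ⟨hst, (EReal.coe_lt_coe_iff.1 htu).le⟩

theorem diagDist_le (h : I.carrier ⊆ Set.Icc a b) : I.diagDist ≤ ENNReal.ofReal (b - a) := by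
  obtain ⟨t, ht⟩ := I.nonempty
  have hab : a ≤ b := (h ht).1.trans (h ht).2
  have ha : (a : EReal) ∈ Set.Icc (a : EReal) b := ⟨le_rfl, EReal.coe_le_coe_iff.2 hab⟩
  have hbirth := I.le_birth fun s hs => (h hs).1
  have hdeath := I.death_le fun s hs => (h hs).2
  exact (iInf_le _ a).trans (max_le
    (extDist_le_of_mem_Icc ⟨hbirth, (I.birth_le ht).trans ((I.le_death ht).trans hdeath)⟩ ha)
    (extDist_le_of_mem_Icc ⟨hbirth.trans ((I.birth_le ht).trans (I.le_death ht)), hdeath⟩ ha))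

end RInterval

theorem exists_pequiv_of_injective {A X Y : Type*} {f : A → X} {g : A → Y}
    (hf : Function.Injective f) (hg : Function.Injective g) :
    ∃ σ : X ≃. Y, ∀ x y, σ x = some y ↔ ∃ a, f a = x ∧ g a = y := by
  have hfg (x : X) (y : Y) :
      (Function.partialInv f x).map g = some y ↔ ∃ a, f a = x ∧ g a = y := by
    simp only [Option.map_eq_some_iff, hf.isPartialInv _ x]
  have hgf (x : X) (y : Y) :
      (Function.partialInv g y).map f = some x ↔ ∃ a, f a = x ∧ g a = y := by
    simp only [Option.map_eq_some_iff, hg.isPartialInv _ y, and_comm]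
  exact ⟨⟨fun x => (Function.partialInv f x).map g, fun y => (Function.partialInv g y).map f,
    fun x y => (hgf x y).trans (hfg x y).symm⟩, hfg⟩

theorem bottleneckDist_le_of_injective {A : Type*} {C D : Barcode} {f : A → C.ι} {g : A → D.ι}
    (hf : Function.Injective f) (hg : Function.Injective g) {c : ℝ≥0∞}
    (hfg : ∀ a, (C.bar (f a)).pointDist (D.bar (g a)) ≤ c)
    (hC : ∀ i ∉ Set.range f, (C.bar i).diagDist ≤ c)
    (hD : ∀ j ∉ Set.range g, (D.bar j).diagDist ≤ c) : bottleneckDist C D ≤ c := by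
  obtain ⟨σ, hσ⟩ := exists_pequiv_of_injective hf hg
  have hσfg (a : A) : σ (f a) = some (g a) := (hσ _ _).2 ⟨a, rfl, rfl⟩
  refine (iInf_le _ σ).trans (sup_le ?_ (sup_le ?_ ?_))
  · refine iSup_le fun i => iSup_le fun j => iSup_le fun hij => ?_
    obtain ⟨a, rfl, rfl⟩ := (hσ i j).1 hij
    exact hfg a
  · refine iSup_le fun i => iSup_le fun hi => hC i ?_
    rintro ⟨a, rfl⟩
    exact Option.some_ne_none _ ((hσfg a).symm.trans hi)
  · refine iSup_le fun j => iSup_le fun hj => hD j ?_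
    rintro ⟨a, rfl⟩
    exact Option.some_ne_none _ ((σ.eq_some_iff.2 (hσfg a)).symm.trans hj)

namespace Barcode

/-- The number of bars that are alive at time `t`. -/
def bettiCurve (C : Barcode) (t : ℝ) : ℕ := {i | t ∈ (C.bar i).carrier}.ncard

/-- No bar reaches below time `0`, and every bar that lives at time `T` or later is already alive
at time `T`. After time `T` such a barcode is determined by its Betti curve. -/
def IsBornBefore (C : Barcode) (T : ℝ) : Prop :=
  ∀ i, ∀ t ∈ (C.bar i).carrier, 0 ≤ t ∧ (T ≤ t → T ∈ (C.bar i).carrier)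

/-- An enumeration of the bars that are alive at time `T`, the longest-lived ones first. -/
structure DeathEnumeration (C : Barcode) (T : ℝ) where
  /-- The enumeration. -/
  toFun : Fin (C.bettiCurve T) → C.ι
  injective : Function.Injective toFun
  range_eq : Set.range toFun = {i | T ∈ (C.bar i).carrier}
  antitone_death : Antitone fun j => (C.bar (toFun j)).death

instance (C : Barcode) (T : ℝ) : Nonempty (C.DeathEnumeration T) := by
  let e : Fin (C.bettiCurve T) ≃ {i | T ∈ (C.bar i).carrier} :=
    (Finite.equivFinOfCardEq (Nat.card_coe_set_eq _)).symm
  let death (j : Fin (C.bettiCurve T)) : EReal := (C.bar (e j)).death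
  let σ := (Fin.revPerm.trans (Tuple.sort death)).trans e
  refine ⟨⟨fun j => σ j, Subtype.val_injective.comp σ.injective, ?_,
    (Tuple.monotone_sort death).comp_antitone Fin.rev_anti⟩⟩
  exact (σ.surjective.range_comp Subtype.val).trans Subtype.range_coe

namespace DeathEnumeration

variable {C D : Barcode} {T t ε : ℝ} (e : C.DeathEnumeration T) (e' : D.DeathEnumeration T)

theorem mem_carrier (j : Fin (C.bettiCurve T)) : T ∈ (C.bar (e.toFun j)).carrier :=
  e.range_eq.le ⟨j, rfl⟩

theorem lt_bettiCurve (hTt : T ≤ t) {j : Fin (C.bettiCurve T)}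
    (ht : (t : EReal) < (C.bar (e.toFun j)).death) : j < C.bettiCurve t := by
  have hsub : e.toFun '' Set.Iic j ⊆ {i | t ∈ (C.bar i).carrier} :=
    Set.image_subset_iff.2 fun j' hj' => (C.bar _).mem_of_lt_death (e.mem_carrier j') hTt
      (ht.trans_le (e.antitone_death hj'))
  have hcard := Set.ncard_le_ncard hsub
  rwa [Set.ncard_image_of_injective _ e.injective, ← Finset.coe_Iic, Set.ncard_coe_finset,
    Fin.card_Iic] at hcard

theorem le_death_of_lt_bettiCurve (hC : C.IsBornBefore T) (hTt : T ≤ t)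
    {j : Fin (C.bettiCurve T)} (hj : j < C.bettiCurve t) :
    (t : EReal) ≤ (C.bar (e.toFun j)).death := by
  by_contra! hlt
  have hsub : {i | t ∈ (C.bar i).carrier} ⊆ e.toFun '' Set.Iio j := fun i hi => by
    obtain ⟨j', rfl⟩ := e.range_eq.ge ((hC i t hi).2 hTt)
    refine ⟨j', Set.mem_Iio.2 (lt_of_not_ge fun hj' => ?_), rfl⟩
    exact (((C.bar _).le_death hi).trans (e.antitone_death hj')).not_gt hlt
  have hcard := Set.ncard_le_ncard hsub
  rw [Set.ncard_image_of_injective _ e.injective, ← Finset.coe_Iio, Set.ncard_coe_finset,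
    Fin.card_Iio] at hcard
  exact hj.not_ge hcard

theorem death_le_add (hε : 0 ≤ ε) (hD : D.IsBornBefore T)
    (hCD : ∀ t, T ≤ t → C.bettiCurve (t + ε) ≤ D.bettiCurve t)
    {j : Fin (C.bettiCurve T)} {j' : Fin (D.bettiCurve T)} (hj : (j : ℕ) = j') :
    (C.bar (e.toFun j)).death ≤ (D.bar (e'.toFun j')).death + ε := by
  refine EReal.ge_of_forall_gt_iff_ge.1 fun t ht => ?_
  have hle : ((t - ε : ℝ) : EReal) ≤ (D.bar (e'.toFun j')).death := by
    rcases le_total (t - ε) T with htT | hTt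
    · exact (EReal.coe_le_coe_iff.2 htT).trans ((D.bar _).le_death (e'.mem_carrier j'))
    · have hj_lt : (j : ℕ) < C.bettiCurve t := e.lt_bettiCurve (by linarith) ht
      have hbetti := hCD (t - ε) hTt
      rw [sub_add_cancel] at hbetti
      exact e'.le_death_of_lt_bettiCurve hD hTt (hj ▸ hj_lt.trans_le hbetti)
  calc (t : EReal) = ((t - ε : ℝ) : EReal) + ε := by rw [← EReal.coe_add, sub_add_cancel]
    _ ≤ (D.bar (e'.toFun j')).death + ε := add_le_add_left hle _

theorem pointDist_le (hε : 0 ≤ ε) (hC : C.IsBornBefore T) (hD : D.IsBornBefore T)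
    (hCD : ∀ t, T ≤ t → C.bettiCurve (t + ε) ≤ D.bettiCurve t)
    (hDC : ∀ t, T ≤ t → D.bettiCurve (t + ε) ≤ C.bettiCurve t)
    {j : Fin (C.bettiCurve T)} {j' : Fin (D.bettiCurve T)} (hj : (j : ℕ) = j') :
    (C.bar (e.toFun j)).pointDist (D.bar (e'.toFun j')) ≤ ENNReal.ofReal (T + ε) := by
  have hT : 0 ≤ T := (hC _ T (e.mem_carrier j)).1
  refine max_le ?_ ?_
  · have birth_mem {C : Barcode} (hC : C.IsBornBefore T) {i : C.ι} (hi : T ∈ (C.bar i).carrier) :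
        (C.bar i).birth ∈ Set.Icc ((0 : ℝ) : EReal) T :=
      ⟨(C.bar i).le_birth fun t ht => (hC i t ht).1, (C.bar i).birth_le hi⟩
    refine (extDist_le_of_mem_Icc (birth_mem hC (e.mem_carrier j))
      (birth_mem hD (e'.mem_carrier j'))).trans (ENNReal.ofReal_le_ofReal (by linarith))
  · have death_ne_bot {C : Barcode} {i : C.ι} (hi : T ∈ (C.bar i).carrier) :
        (C.bar i).death ≠ ⊥ := ((EReal.bot_lt_coe T).trans_le ((C.bar i).le_death hi)).ne'
    exact (extDist_le (death_ne_bot (e.mem_carrier j)) (death_ne_bot (e'.mem_carrier j'))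
      (e.death_le_add e' hε hD hCD hj) (e'.death_le_add e hε hC hDC hj.symm)).trans
      (ENNReal.ofReal_le_ofReal (by linarith))

theorem diagDist_le (hε : 0 ≤ ε) (hC : C.IsBornBefore T)
    (hCD : ∀ t, T ≤ t → C.bettiCurve (t + ε) ≤ D.bettiCurve t) {i : C.ι}
    (hi : ∀ j : Fin (C.bettiCurve T), j < D.bettiCurve T → e.toFun j ≠ i) :
    (C.bar i).diagDist ≤ ENNReal.ofReal (T + ε) := by
  have hsub : (C.bar i).carrier ⊆ Set.Icc 0 (T + ε) := fun t ht => by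
    refine ⟨(hC i t ht).1, ?_⟩
    by_contra! hlt
    obtain ⟨j, rfl⟩ := e.range_eq.ge ((hC i t ht).2 (by linarith))
    have hj : (j : ℕ) < C.bettiCurve (T + ε) := e.lt_bettiCurve (by linarith)
      ((EReal.coe_lt_coe_iff.2 hlt).trans_le ((C.bar _).le_death ht))
    exact hi j (hj.trans_le (hCD T le_rfl)) rfl
  simpa only [sub_zero] using (C.bar i).diagDist_le hsub

end DeathEnumeration

theorem bottleneckDist_le_of_bettiCurve_le {C D : Barcode} {T ε : ℝ} (hε : 0 ≤ ε)
    (hC : C.IsBornBefore T) (hD : D.IsBornBefore T)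
    (hCD : ∀ t, T ≤ t → C.bettiCurve (t + ε) ≤ D.bettiCurve t)
    (hDC : ∀ t, T ≤ t → D.bettiCurve (t + ε) ≤ C.bettiCurve t) :
    bottleneckDist C D ≤ ENNReal.ofReal (T + ε) := by
  obtain ⟨e⟩ : Nonempty (C.DeathEnumeration T) := inferInstance
  obtain ⟨e'⟩ : Nonempty (D.DeathEnumeration T) := inferInstance
  let m := min (C.bettiCurve T) (D.bettiCurve T)
  exact bottleneckDist_le_of_injective
    (f := e.toFun ∘ Fin.castLE (min_le_left _ _ : m ≤ _))
    (g := e'.toFun ∘ Fin.castLE (min_le_right _ _ : m ≤ _))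
    (e.injective.comp (Fin.castLE_injective _)) (e'.injective.comp (Fin.castLE_injective _))
    (fun j => e.pointDist_le e' hε hC hD hCD hDC rfl)
    (fun i hi => e.diagDist_le hε hC hCD fun j hj hji => hi ⟨⟨j, lt_min j.2 hj⟩, hji⟩)
    (fun i hi => e'.diagDist_le hε hD hDC fun j hj hji => hi ⟨⟨j, lt_min hj j.2⟩, hji⟩)

/-- The barcode with bars `{t | 0 ≤ t ∧ k < β t}` for `k < β 0`, whose Betti curve is `β` at
nonnegative times and `0` at negative times. -/
def ofAntitone {β : ℝ → ℕ} (hβ : Antitone β) : Barcode where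
  ι := Fin (β 0)
  bar k :=
    { carrier := {t | 0 ≤ t ∧ k < β t}
      nonempty := ⟨0, le_rfl, k.2⟩
      ordConnected := ⟨fun _ hs _ ht _ hu => ⟨hs.1.trans hu.1, ht.2.trans_le (hβ hu.2)⟩⟩ }

theorem isBornBefore_ofAntitone {β : ℝ → ℕ} (hβ : Antitone β) {T : ℝ} (hT : 0 ≤ T) :
    (ofAntitone hβ).IsBornBefore T := fun _ _ ht =>
  ⟨ht.1, fun hTt => ⟨hT, ht.2.trans_le (hβ hTt)⟩⟩

theorem bettiCurve_ofAntitone {β : ℝ → ℕ} (hβ : Antitone β) {t : ℝ} (ht : 0 ≤ t) :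
    (ofAntitone hβ).bettiCurve t = β t := by
  have himage : {k : Fin (β 0) | 0 ≤ t ∧ (k : ℕ) < β t} =
      Set.range (Fin.castLE (hβ ht)) := by
    ext k
    exact ⟨fun hk => ⟨⟨k, hk.2⟩, rfl⟩, by rintro ⟨j, rfl⟩; exact ⟨ht, j.2⟩⟩
  calc (ofAntitone hβ).bettiCurve t = (Set.range (Fin.castLE (hβ ht))).ncard :=
        congrArg Set.ncard himage
    _ = β t := by
        rw [← Nat.card_coe_set_eq, Nat.card_range_of_injective (Fin.castLE_injective _),
          Nat.card_fin]

end Barcode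

/-! ### Barcodes and dimensions -/

open scoped Classical in
theorem RInterval.finrank_fiber (I : RInterval) (t : ℝ) :
    Module.finrank ℝ (I.fiber t) = if t ∈ I.carrier then 1 else 0 := by
  split_ifs with ht
  · rw [show I.fiber t = ⊤ from eq_top_iff.2 fun _ _ h => absurd ht h, finrank_top,
      Module.finrank_self]
  · rw [show I.fiber t = ⊥ from eq_bot_iff.2 fun _ hx => hx ht, finrank_bot]

section IsBarcode

variable {M : PersVec} {C : Barcode}

theorem IsBarcode.finrank_eq (hM : IsBarcode M C) (t : ℝ) :
    Module.finrank ℝ (M.obj t) = C.bettiCurve t := by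
  classical
  obtain ⟨e⟩ := hM
  have := Fintype.ofFinite C.ι
  calc Module.finrank ℝ (M.obj t) = Module.finrank ℝ (∀ i, (C.bar i).fiber t) :=
        (e.app t).toLinearEquiv.finrank_eq
    _ = ∑ i, if t ∈ (C.bar i).carrier then 1 else 0 := by
        simp only [Module.finrank_pi_fintype, RInterval.finrank_fiber]
    _ = C.bettiCurve t := by
        rw [Finset.sum_boole, Nat.cast_id, Barcode.bettiCurve, Set.ncard_eq_toFinset_card',
          Set.toFinset_ofPred]

theorem IsBarcode.mem_of_surjective (hM : IsBarcode M C) {s t : ℝ} (hst : s ≤ t)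
    (hsurj : Function.Surjective (M.map (homOfLE hst)).hom) {i : C.ι}
    (ht : t ∈ (C.bar i).carrier) : s ∈ (C.bar i).carrier := by
  classical
  obtain ⟨e⟩ := hM
  by_contra hs
  let y : ∀ i, (C.bar i).fiber t := Pi.single i ⟨1, fun h => absurd ht h⟩
  obtain ⟨x, hx⟩ := hsurj ((e.inv.app t).hom y)
  let z : ∀ i, (C.bar i).fiber s := (e.hom.app s).hom x
  have hzy : (C.bar i).fiberMap s t (z i) = y i := by
    have hnat := congrArg (fun φ => φ.hom x) (e.hom.naturality (homOfLE hst))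
    have hinv := congrArg (fun φ => φ.hom y) (e.inv_hom_id_app t)
    exact congrFun (hnat.symm.trans ((congrArg (e.hom.app t).hom hx).trans hinv)) i
  have hz : z i = 0 := Subtype.ext ((C.bar i).coe_fiber_eq_zero hs _)
  have hone : (1 : ℝ) = 0 := by
    simpa only [hz, map_zero, y, Pi.single_eq_same, ZeroMemClass.coe_zero, eq_comm]
      using congrArg Subtype.val hzy
  exact one_ne_zero hone

end IsBarcode
/-! ### Regular paths and induced chain maps -/

section Chains

variable {V V' : Type}

open scoped Classical in
/-- The elementary path `v` if it is regular, and `0` otherwise. -/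
def regularPath {p : ℕ} (v : Fin (p + 1) → V) : Chains V p :=
  if IsRegular v then Finsupp.single v 1 else 0

/-- The elementary `0`-path at `a`. -/
def vertex (a : V) : Chains V 0 := regularPath ![a]

/-- The elementary `1`-path `a b`, which is `0` if `a = b`. -/
def edge (a b : V) : Chains V 1 := regularPath ![a, b]

theorem regularPath_of_isRegular {p : ℕ} {v : Fin (p + 1) → V} (hv : IsRegular v) :
    regularPath v = Finsupp.single v 1 := if_pos hv

theorem regularPath_of_not_isRegular {p : ℕ} {v : Fin (p + 1) → V} (hv : ¬ IsRegular v) :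
    regularPath v = 0 := if_neg hv

theorem isRegular_one {v : Fin (1 + 1) → V} : IsRegular v ↔ v 0 ≠ v 1 := Fin.forall_fin_one

theorem isAllowed_one {K : Digraph V} {v : Fin (1 + 1) → V} :
    IsAllowed K v ↔ K.Adj (v 0) (v 1) := Fin.forall_fin_one

theorem isAllowed_two {K : Digraph V} {v : Fin (2 + 1) → V} :
    IsAllowed K v ↔ K.Adj (v 0) (v 1) ∧ K.Adj (v 1) (v 2) := Fin.forall_fin_two

@[simp]
theorem edge_self (a : V) : edge a a = 0 :=
  regularPath_of_not_isRegular fun h => isRegular_one.1 h rfl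

theorem boundary_single {p : ℕ} (v : Fin (p + 2) → V) :
    boundary V p (Finsupp.single v 1) =
      ∑ i : Fin (p + 2), (-1 : ℝ) ^ (i : ℕ) • regularPath (v ∘ i.succAbove) := by
  rw [boundary, Finsupp.linearCombination_single, one_smul]
  rfl

theorem not_isRegular_comp_succAbove {p : ℕ} {v : Fin (p + 2) → V} {j : Fin (p + 1)}
    (hj : v j.castSucc = v j.succ) {i : Fin (p + 2)} (hi : i ≠ j.castSucc) (hi' : i ≠ j.succ) :
    ¬ IsRegular (v ∘ i.succAbove) := by
  obtain ⟨k, hk, hk'⟩ : ∃ k : Fin p,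
      i.succAbove k.castSucc = j.castSucc ∧ i.succAbove k.succ = j.succ := by
    simp only [ne_eq, Fin.ext_iff, Fin.val_castSucc, Fin.val_succ] at hi hi'
    have hjp := j.2
    rcases lt_or_gt_of_ne hi with hij | hij
    · exact ⟨⟨j - 1, by omega⟩, by grind [Fin.succAbove], by grind [Fin.succAbove]⟩
    · exact ⟨⟨j, by omega⟩, by grind [Fin.succAbove], by grind [Fin.succAbove]⟩
  exact fun h => h k (by rw [Function.comp_apply, Function.comp_apply, hk, hk', hj])

theorem sum_faces_of_not_isRegular {p : ℕ} {v : Fin (p + 2) → V} (hv : ¬ IsRegular v) :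
    ∑ i : Fin (p + 2), (-1 : ℝ) ^ (i : ℕ) • regularPath (v ∘ i.succAbove) = 0 := by
  obtain ⟨j, hj⟩ : ∃ j : Fin (p + 1), v j.castSucc = v j.succ := by
    simpa only [IsRegular, not_forall, not_not] using hv
  have hface : v ∘ j.castSucc.succAbove = v ∘ j.succ.succAbove := by
    funext k
    rcases eq_or_ne k j with rfl | hkj
    · simp [hj]
    · refine congrArg v (hkj.lt_or_gt.elim (fun h => ?_) fun h => ?_)
      · rw [Fin.succAbove_castSucc_of_lt _ _ h, Fin.succAbove_succ_of_le _ _ h.le]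
      · rw [Fin.succAbove_castSucc_of_le _ _ h.le, Fin.succAbove_succ_of_lt _ _ h]
  rw [Finset.sum_eq_add j.castSucc j.succ j.castSucc_lt_succ.ne
    (fun i _ hi => by
      rw [regularPath_of_not_isRegular (not_isRegular_comp_succAbove hj hi.1 hi.2), smul_zero])
    (fun h => absurd (Finset.mem_univ _) h) (fun h => absurd (Finset.mem_univ _) h),
    hface, ← add_smul, Fin.val_castSucc, Fin.val_succ, pow_succ, mul_neg_one, add_neg_cancel,
    zero_smul]

theorem boundary_regularPath {p : ℕ} (v : Fin (p + 2) → V) :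
    boundary V p (regularPath v) =
      ∑ i : Fin (p + 2), (-1 : ℝ) ^ (i : ℕ) • regularPath (v ∘ i.succAbove) := by
  by_cases hv : IsRegular v
  · rw [regularPath_of_isRegular hv, boundary_single]
  · rw [regularPath_of_not_isRegular hv, map_zero, sum_faces_of_not_isRegular hv]

theorem sum_faces_one (v : Fin 2 → V) :
    ∑ i : Fin 2, (-1 : ℝ) ^ (i : ℕ) • regularPath (v ∘ i.succAbove) =
      vertex (v 1) - vertex (v 0) := by
  have hv0 : v ∘ (0 : Fin 2).succAbove = ![v 1] := by
    ext i; fin_cases i; rfl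
  have hv1 : v ∘ (1 : Fin 2).succAbove = ![v 0] := by
    ext i; fin_cases i; rfl
  rw [Fin.sum_univ_two, hv0, hv1]
  simp [vertex, sub_eq_add_neg]

theorem sum_faces_two (v : Fin 3 → V) :
    ∑ i : Fin 3, (-1 : ℝ) ^ (i : ℕ) • regularPath (v ∘ i.succAbove) =
      edge (v 1) (v 2) - edge (v 0) (v 2) + edge (v 0) (v 1) := by
  have hv0 : v ∘ (0 : Fin 3).succAbove = ![v 1, v 2] := by
    ext i; fin_cases i <;> rfl
  have hv1 : v ∘ (1 : Fin 3).succAbove = ![v 0, v 2] := by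
    ext i; fin_cases i <;> rfl
  have hv2 : v ∘ (2 : Fin 3).succAbove = ![v 0, v 1] := by
    ext i; fin_cases i <;> rfl
  rw [Fin.sum_univ_three, hv0, hv1, hv2]
  simp [edge, sub_eq_add_neg]

theorem boundary_zero_edge (a b : V) : boundary V 0 (edge a b) = vertex b - vertex a :=
  (boundary_regularPath ![a, b]).trans (sum_faces_one ![a, b])

theorem boundary_zero_boundary_one (x : Chains V 2) : boundary V 0 (boundary V 1 x) = 0 := by
  suffices boundary V 0 ∘ₗ boundary V 1 = 0 from LinearMap.congr_fun this x
  refine Finsupp.lhom_ext' fun v => LinearMap.ext_ring ?_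
  have hfaces : boundary V 1 (Finsupp.single v 1) =
      edge (v 1) (v 2) - edge (v 0) (v 2) + edge (v 0) (v 1) :=
    (boundary_single v).trans (sum_faces_two v)
  simp only [LinearMap.comp_apply, Finsupp.lsingle_apply, hfaces, map_add, map_sub,
    boundary_zero_edge, LinearMap.zero_apply]
  abel

theorem allowed_le {K : Digraph V} {p : ℕ} {X : Submodule ℝ (Chains V p)}
    (h : ∀ v, IsAllowed K v → Finsupp.single v 1 ∈ X) : allowed K p ≤ X := by
  rw [allowed, Finsupp.supported_eq_span_single, Submodule.span_le]
  exact Set.forall_mem_image.2 h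

theorem allowed_one_le {K : Digraph V} (hK : ∀ a, ¬ K.Adj a a) {X : Submodule ℝ (Chains V 1)}
    (h : ∀ a b, K.Adj a b → edge a b ∈ X) : allowed K 1 ≤ X := by
  refine allowed_le fun v hv => ?_
  have hadj := isAllowed_one.1 hv
  have hv_eq : v = ![v 0, v 1] := by
    ext i; fin_cases i <;> rfl
  rw [← regularPath_of_isRegular (isRegular_one.2 fun h01 => hK _ (h01 ▸ hadj)), hv_eq]
  exact h _ _ hadj

theorem regularPath_mem_allowed {K : Digraph V} {p : ℕ} {v : Fin (p + 1) → V}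
    (h : IsRegular v → IsAllowed K v) : regularPath v ∈ allowed K p := by
  by_cases hv : IsRegular v
  · rw [regularPath_of_isRegular hv]
    exact Finsupp.single_mem_supported ℝ _ (h hv)
  · rw [regularPath_of_not_isRegular hv]
    exact zero_mem _

theorem edge_mem_allowed {K : Digraph V} {a b : V} (h : K.Adj a b) : edge a b ∈ allowed K 1 :=
  regularPath_mem_allowed fun _ => isAllowed_one.2 h

theorem mem_cycles {K : Digraph V} {x : Chains V 1} :
    x ∈ cycles K ↔ x ∈ allowed K 1 ∧ boundary V 0 x = 0 :=
  ⟨fun h => ⟨h.1.1, h.2⟩, fun h => ⟨⟨h.1, fun _ _ i => i.elim0⟩, h.2⟩⟩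

theorem cycles_eq_bot {K : Digraph V} (hK : ∀ a b, ¬ K.Adj a b) : cycles K = ⊥ :=
  eq_bot_iff.2 fun _ hx => allowed_one_le (fun a => hK a a) (fun a b hab => absurd hab (hK a b))
    (mem_cycles.1 hx).1

theorem boundaries_le_cycles (K : Digraph V) : boundaries K ≤ cycles K := by
  rintro _ ⟨x, hx, rfl⟩
  exact mem_cycles.2 ⟨hx.2, boundary_zero_boundary_one x⟩

theorem triangle_mem_boundaries {K : Digraph V} {a b c : V} (hab : K.Adj a b) (hbc : K.Adj b c)
    (hac : K.Adj a c) : edge b c - edge a c + edge a b ∈ boundaries K := by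
  have hboundary : boundary V 1 (regularPath ![a, b, c]) = edge b c - edge a c + edge a b :=
    (boundary_regularPath _).trans (sum_faces_two _)
  refine ⟨_, ⟨regularPath_mem_allowed fun _ => isAllowed_two.2 ⟨hab, hbc⟩,
    Submodule.mem_comap.2 ?_⟩, hboundary⟩
  rw [hboundary]
  exact add_mem (sub_mem (edge_mem_allowed hbc) (edge_mem_allowed hac)) (edge_mem_allowed hab)

/-- The map of path chains induced by a map of vertices; paths with irregular image are sent
to `0`. -/
def push (f : V → V') (p : ℕ) : Chains V p →ₗ[ℝ] Chains V' p :=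
  Finsupp.linearCombination ℝ fun v => regularPath (f ∘ v)

theorem push_single (f : V → V') {p : ℕ} (v : Fin (p + 1) → V) :
    push f p (Finsupp.single v 1) = regularPath (f ∘ v) := by
  rw [push, Finsupp.linearCombination_single, one_smul]

theorem push_regularPath (f : V → V') {p : ℕ} (v : Fin (p + 1) → V) :
    push f p (regularPath v) = regularPath (f ∘ v) := by
  by_cases hv : IsRegular v
  · rw [regularPath_of_isRegular hv, push_single]
  · rw [regularPath_of_not_isRegular hv, map_zero, regularPath_of_not_isRegular fun hfv => hv
      fun i hi => hfv i (congrArg f hi)]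

theorem push_vertex (f : V → V') (a : V) : push f 0 (vertex a) = vertex (f a) := by
  rw [vertex, push_regularPath, vertex]
  congr 1
  ext i; fin_cases i; rfl

@[simp]
theorem push_edge (f : V → V') (a b : V) : push f 1 (edge a b) = edge (f a) (f b) := by
  rw [edge, push_regularPath, edge]
  congr 1
  ext i; fin_cases i <;> rfl

theorem boundary_push (f : V → V') {p : ℕ} (x : Chains V (p + 1)) :
    boundary V' p (push f (p + 1) x) = push f p (boundary V p x) := by
  suffices boundary V' p ∘ₗ push f (p + 1) = push f p ∘ₗ boundary V p from
    LinearMap.congr_fun this x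
  refine Finsupp.lhom_ext' fun v => LinearMap.ext_ring ?_
  simp only [LinearMap.comp_apply, Finsupp.lsingle_apply, push_single, boundary_regularPath,
    boundary_single, map_sum, map_smul, push_regularPath, Function.comp_assoc]

/-- A weak digraph map: edges are mapped to edges or collapsed. -/
def IsWeakMap (K : Digraph V) (K' : Digraph V') (f : V → V') : Prop :=
  ∀ a b, K.Adj a b → f a = f b ∨ K'.Adj (f a) (f b)

variable {K : Digraph V} {K' : Digraph V'} {f : V → V'}

theorem IsWeakMap.push_mem_allowed (hf : IsWeakMap K K' f) {p : ℕ} {x : Chains V p}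
    (hx : x ∈ allowed K p) : push f p x ∈ allowed K' p := by
  suffices allowed K p ≤ (allowed K' p).comap (push f p) from this hx
  refine allowed_le fun v hv => ?_
  rw [Submodule.mem_comap, push_single]
  exact regularPath_mem_allowed fun hfv i => (hf _ _ (hv i)).resolve_left (hfv i)

theorem IsWeakMap.push_mem_cycles (hf : IsWeakMap K K' f) {x : Chains V 1} (hx : x ∈ cycles K) :
    push f 1 x ∈ cycles K' := by
  rw [mem_cycles] at hx ⊢
  exact ⟨hf.push_mem_allowed hx.1, by rw [boundary_push, hx.2, map_zero]⟩

theorem IsWeakMap.push_mem_boundaries (hf : IsWeakMap K K' f) {x : Chains V 1}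
    (hx : x ∈ boundaries K) : push f 1 x ∈ boundaries K' := by
  obtain ⟨y, ⟨hy, hboundary⟩, rfl⟩ := hx
  refine ⟨push f 2 y, ⟨hf.push_mem_allowed hy, Submodule.mem_comap.2 ?_⟩, boundary_push f y⟩
  rw [boundary_push]
  exact hf.push_mem_allowed hboundary

end Chains

/-! ### Ranks of quotients of subspaces -/

section QuotientRank

variable {k E F : Type*} [DivisionRing k] [AddCommGroup E] [Module k E] [AddCommGroup F]
  [Module k F] {Z B : Submodule k E}

/-- The dimension of `Z / (B ∩ Z)`, i.e. of the image of `Z` in the quotient by `B`. -/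
def quotientRank (Z B : Submodule k E) : ℕ := Module.finrank k (Z ⧸ B.submoduleOf Z)

theorem quotientRank_bot (B : Submodule k E) : quotientRank ⊥ B = 0 :=
  Module.finrank_zero_of_subsingleton

theorem quotientRank_sup (Z B : Submodule k E) : quotientRank (Z ⊔ B) B = quotientRank Z B := by
  have hcomap : (Z ⊓ B).submoduleOf Z = B.submoduleOf Z := by
    simp [Submodule.submoduleOf]
  rw [quotientRank, quotientRank, ← hcomap]
  exact (LinearMap.quotientInfEquivSupQuotient Z B).finrank_eq.symm

theorem quotientRank_map_le [FiniteDimensional k E] (φ : E →ₗ[k] F) {B' : Submodule k F}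
    (hB : ∀ x ∈ Z, x ∈ B → φ x ∈ B') : quotientRank (Z.map φ) B' ≤ quotientRank Z B := by
  have hφ : B.submoduleOf Z ≤ (B'.submoduleOf (Z.map φ)).comap (φ.submoduleMap Z) :=
    fun x hx => hB x x.2 hx
  have hsurj : Function.Surjective (Submodule.mapQ _ _ (φ.submoduleMap Z) hφ) :=
    .of_comp (g := Submodule.mkQ _)
      ((Submodule.mkQ_surjective _).comp (φ.submoduleMap_surjective Z))
  exact LinearMap.finrank_le_finrank_of_surjective hsurj

theorem quotientRank_anti [FiniteDimensional k E] {B' : Submodule k E} (hB : B ≤ B') :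
    quotientRank Z B' ≤ quotientRank Z B := by
  simpa only [Submodule.map_id] using
    quotientRank_map_le (Z := Z) LinearMap.id fun _ _ hx => hB hx

end QuotientRank

/-! ### Walks and the shortest-path filtration -/

namespace WDigraph

variable {G : WDigraph}

theorem ne_of_adj {a b : G.V} (h : G.graph.Adj a b) : a ≠ b := by
  rintro rfl
  exact G.loopless _ h

/-- There is a directed walk of length `r` from `a` to `b`. Unlike the paths of `IsPath`, walks may
repeat vertices, so that they can be concatenated and mapped. -/
inductive Walk (G : WDigraph) : G.V → G.V → ℝ → Prop
  | refl (a : G.V) : Walk G a a 0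
  | cons {a c b : G.V} {r : ℝ} (h : G.graph.Adj a c) (hr : Walk G c b r) :
      Walk G a b (G.w a c + r)

theorem Walk.of_adj {a b : G.V} (h : G.graph.Adj a b) : G.Walk a b (G.w a b) := by
  simpa using Walk.cons h (Walk.refl b)

theorem Walk.nonneg {a b : G.V} {r : ℝ} (h : G.Walk a b r) : 0 ≤ r := by
  induction h with
  | refl => exact le_rfl
  | cons h _ ih => exact add_nonneg (G.w_pos _ _ h).le ih

theorem Walk.of_isChain {b : G.V} : ∀ {a : G.V} {l : List G.V}, (a :: l).IsChain G.graph.Adj →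
    (a :: l).getLast? = some b → G.Walk a b (G.pathLength (a :: l))
  | a, [], _, hb => by
    obtain rfl : a = b := by simpa using hb
    exact Walk.refl a
  | a, c :: l, h, hb => by
    rw [List.isChain_cons_cons] at h
    rw [List.getLast?_cons_cons] at hb
    exact Walk.cons h.1 (Walk.of_isChain h.2 hb)

theorem IsPath.walk {a b : G.V} {l : List G.V} (h : G.IsPath a b l) :
    G.Walk a b (G.pathLength l) := by
  obtain ⟨hchain, -, hhead, hlast⟩ := h
  obtain ⟨l, rfl⟩ := List.head?_eq_some_iff.1 hhead
  exact Walk.of_isChain hchain hlast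

theorem pathLength_le_append {l : List G.V} :
    ∀ {k : List G.V}, (k ++ l).IsChain G.graph.Adj → G.pathLength l ≤ G.pathLength (k ++ l)
  | [], _ => le_rfl
  | a :: k, h => by
    refine (pathLength_le_append h.tail).trans ?_
    rw [List.cons_append] at h ⊢
    rcases hkl : k ++ l with - | ⟨c, m⟩
    · exact le_rfl
    · rw [hkl, List.isChain_cons_cons] at h
      exact le_add_of_nonneg_left (G.w_pos _ _ h.1).le

theorem IsPath.exists_isPath_of_mem {a b c : G.V} {l : List G.V} (h : G.IsPath c b l)
    (ha : a ∈ l) : ∃ m, G.IsPath a b m ∧ G.pathLength m ≤ G.pathLength l := by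
  obtain ⟨hchain, hnodup, -, hlast⟩ := h
  obtain ⟨k, m, rfl⟩ := List.append_of_mem ha
  refine ⟨a :: m, ⟨hchain.right_of_append, hnodup.of_append_right, rfl, ?_⟩,
    pathLength_le_append hchain⟩
  rwa [List.getLast?_append_of_ne_nil _ (List.cons_ne_nil a m)] at hlast

theorem Walk.exists_isPath {a b : G.V} {r : ℝ} (h : G.Walk a b r) :
    ∃ l, G.IsPath a b l ∧ G.pathLength l ≤ r := by
  induction h with
  | refl a => exact ⟨[a], ⟨List.isChain_singleton a, List.nodup_singleton a, rfl, rfl⟩, le_rfl⟩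
  | @cons a c b r hac _ ih =>
    obtain ⟨l, hl, hlr⟩ := ih
    by_cases ha : a ∈ l
    · obtain ⟨m, hm, hml⟩ := hl.exists_isPath_of_mem ha
      exact ⟨m, hm, (hml.trans hlr).trans (le_add_of_nonneg_left (G.w_pos _ _ hac).le)⟩
    · obtain ⟨hchain, hnodup, hhead, hlast⟩ := hl
      obtain ⟨l, rfl⟩ := List.head?_eq_some_iff.1 hhead
      exact ⟨a :: c :: l, ⟨hchain.cons_cons hac, hnodup.cons ha, rfl,
        List.getLast?_cons_cons.trans hlast⟩, add_le_add_right hlr _⟩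

theorem exists_isPath_of_dist_le {a b : G.V} {t : ℝ} (h : G.dist a b ≤ (t : EReal)) :
    ∃ l, G.IsPath a b l ∧ G.pathLength l ≤ t := by
  have hdist : G.dist a b = sInf ((fun l => (G.pathLength l : EReal)) '' {l | G.IsPath a b l}) :=
    sInf_image.symm
  classical
  have := Fintype.ofFinite G.V
  have hfin : {l | G.IsPath a b l}.Finite :=
    Set.Finite.subset (Finite.of_fintype {l : List G.V // l.Nodup}) fun _ hl => hl.2.1
  rcases {l | G.IsPath a b l}.eq_empty_or_nonempty with hempty | hne
  · rw [hdist, hempty, Set.image_empty, sInf_empty] at h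
    exact absurd h (not_le.2 (EReal.coe_lt_top t))
  · obtain ⟨l, hl, hmin⟩ := (hne.image fun l => (G.pathLength l : EReal)).csInf_mem (hfin.image _)
    exact ⟨l, hl, EReal.coe_le_coe_iff.1 (hmin.le.trans (hdist.ge.trans h))⟩

theorem dist_le_iff {a b : G.V} {t : ℝ} :
    G.dist a b ≤ (t : EReal) ↔ ∃ r, G.Walk a b r ∧ r ≤ t := by
  constructor
  · intro h
    obtain ⟨l, hl, hlt⟩ := exists_isPath_of_dist_le h
    exact ⟨_, hl.walk, hlt⟩
  · rintro ⟨r, hr, hrt⟩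
    obtain ⟨l, hl, hlr⟩ := hr.exists_isPath
    exact (iInf₂_le l hl).trans (EReal.coe_le_coe_iff.2 (hlr.trans hrt))

theorem shortestPath_adj {a b : G.V} {t : ℝ} :
    (G.shortestPath t).Adj a b ↔ a ≠ b ∧ ∃ r, G.Walk a b r ∧ r ≤ t :=
  and_congr_right fun _ => dist_le_iff

theorem nonneg_of_shortestPath_adj {a b : G.V} {t : ℝ} (h : (G.shortestPath t).Adj a b) :
    0 ≤ t := by
  obtain ⟨-, r, hr, hrt⟩ := shortestPath_adj.1 h
  exact hr.nonneg.trans hrt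

/-- The type of edges of `G`. -/
abbrev Edge (G : WDigraph) : Type := {e : G.V × G.V // G.graph.Adj e.1 e.2}

/-- The largest weight of an edge of `G`, and `0` if `G` has no edges. -/
def mesh (G : WDigraph) : ℝ := ⨆ e : G.Edge, G.w e.1.1 e.1.2

theorem w_le_mesh {a b : G.V} (h : G.graph.Adj a b) : G.w a b ≤ G.mesh :=
  le_ciSup (f := fun e : G.Edge => G.w e.1.1 e.1.2) (Set.finite_range _).bddAbove ⟨(a, b), h⟩

theorem mesh_le {c : ℝ} (h : ∀ a b, G.graph.Adj a b → G.w a b ≤ c) (hc : 0 ≤ c) : G.mesh ≤ c :=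
  Real.iSup_le (fun e => h _ _ e.2) hc

theorem mesh_nonneg (G : WDigraph) : 0 ≤ G.mesh :=
  Real.iSup_nonneg fun e => (G.w_pos _ _ e.2).le

theorem graph_le_shortestPath {t : ℝ} (ht : G.mesh ≤ t) : G.graph ≤ G.shortestPath t :=
  fun _ _ hab =>
    shortestPath_adj.2 ⟨ne_of_adj hab, _, Walk.of_adj hab, (w_le_mesh hab).trans ht⟩

theorem Walk.edge_mem {t : ℝ} (ht : G.mesh ≤ t) {a b : G.V} {r : ℝ} (h : G.Walk a b r)
    (hrt : r ≤ t) : edge a b ∈ allowed G.graph 1 ⊔ boundaries (G.shortestPath t) := by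
  induction h with
  | refl a =>
    rw [edge_self]
    exact zero_mem _
  | @cons a c b r hac hcb ih =>
    have hrt' : r ≤ t := (le_add_of_nonneg_left (G.w_pos _ _ hac).le).trans hrt
    have hedge : edge a c ∈ allowed G.graph 1 ⊔ boundaries (G.shortestPath t) :=
      Submodule.mem_sup_left (edge_mem_allowed hac)
    rcases eq_or_ne a b with rfl | hab
    · rw [edge_self]
      exact zero_mem _
    rcases eq_or_ne c b with rfl | hcb_ne
    · exact hedge
    have htriangle : edge c b - edge a b + edge a c ∈ boundaries (G.shortestPath t) :=
      triangle_mem_boundaries (graph_le_shortestPath ht hac)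
        (shortestPath_adj.2 ⟨hcb_ne, r, hcb, hrt'⟩)
        (shortestPath_adj.2 ⟨hab, _, Walk.cons hac hcb, hrt⟩)
    have hab_eq : edge a b = edge c b + edge a c - (edge c b - edge a b + edge a c) := by abel
    rw [hab_eq]
    exact sub_mem (add_mem (ih hrt') hedge) (Submodule.mem_sup_right htriangle)

theorem cycles_shortestPath {t : ℝ} (ht : G.mesh ≤ t) :
    cycles (G.shortestPath t) = cycles G.graph ⊔ boundaries (G.shortestPath t) := by
  refine le_antisymm (fun x hx => ?_)
    (sup_le (cycles_mono (graph_le_shortestPath ht)) (boundaries_le_cycles _))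
  obtain ⟨hx_allowed, hx_closed⟩ := mem_cycles.1 hx
  have hle : allowed (G.shortestPath t) 1 ≤ allowed G.graph 1 ⊔ boundaries (G.shortestPath t) :=
    allowed_one_le (fun a (h : (G.shortestPath t).Adj a a) => h.1 rfl) fun a b hab => by
      obtain ⟨-, r, hr, hrt⟩ := shortestPath_adj.1 hab
      exact hr.edge_mem ht hrt
  obtain ⟨y, hy, z, hz, rfl⟩ := Submodule.mem_sup.1 (hle hx_allowed)
  rw [map_add, (mem_cycles.1 (boundaries_le_cycles _ hz)).2, add_zero] at hx_closed
  exact add_mem (Submodule.mem_sup_left (mem_cycles.2 ⟨hy, hx_closed⟩))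
    (Submodule.mem_sup_right hz)

/-- The rank of the map from the cycles of `G` to the homology of `G^t`, provided that `G` is
contained in `G^t`. -/
def survivingRank (G : WDigraph) (t : ℝ) : ℕ :=
  quotientRank (cycles G.graph) (boundaries (G.shortestPath t))

theorem survivingRank_antitone (G : WDigraph) : Antitone G.survivingRank := fun _ _ hst =>
  quotientRank_anti (boundaries_mono (G.shortestPath_mono hst))

theorem quotientRank_shortestPath {t : ℝ} (ht : G.mesh ≤ t) :
    quotientRank (cycles (G.shortestPath t)) (boundaries (G.shortestPath t)) =
      G.survivingRank t := by
  rw [cycles_shortestPath ht, quotientRank_sup, survivingRank]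

end WDigraph

/-! ### Medial subdivision -/

namespace WDigraph

section Medial

variable {G : WDigraph}

/-- A vertex of `G` as a vertex of the medial subdivision. -/
def ofVertex (a : G.V) : G.medial.V := Sum.inl a

/-- The midpoint of an edge. -/
def midpoint (e : G.Edge) : G.medial.V := Sum.inr e

theorem adj_ofVertex_midpoint (e : G.Edge) :
    G.medial.graph.Adj (ofVertex e.1.1) (midpoint e) :=
  show e.1.1 = e.1.1 from rfl

theorem adj_midpoint_ofVertex (e : G.Edge) :
    G.medial.graph.Adj (midpoint e) (ofVertex e.1.2) :=
  show e.1.2 = e.1.2 from rfl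

theorem w_ofVertex_midpoint (a : G.V) (e : G.Edge) :
    G.medial.w (ofVertex a) (midpoint e) = G.w e.1.1 e.1.2 / 2 := rfl

theorem w_midpoint_ofVertex (a : G.V) (e : G.Edge) :
    G.medial.w (midpoint e) (ofVertex a) = G.w e.1.1 e.1.2 / 2 := rfl

theorem exists_of_medial_adj : ∀ {x y : G.medial.V}, G.medial.graph.Adj x y →
    ∃ e : G.Edge, (x = ofVertex e.1.1 ∧ y = midpoint e) ∨ (x = midpoint e ∧ y = ofVertex e.1.2)
  | .inl _, .inl _, h => h.elim
  | .inl _, .inr e, h => ⟨e, .inl ⟨congrArg Sum.inl h, rfl⟩⟩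
  | .inr e, .inl _, h => ⟨e, .inr ⟨rfl, congrArg Sum.inl h⟩⟩
  | .inr _, .inr _, h => h.elim

theorem medial_w_le {x y : G.medial.V} (h : G.medial.graph.Adj x y) :
    G.medial.w x y ≤ G.mesh / 2 := by
  obtain ⟨e, ⟨rfl, rfl⟩ | ⟨rfl, rfl⟩⟩ := exists_of_medial_adj h
  · exact div_le_div_of_nonneg_right (w_le_mesh e.2) zero_le_two
  · exact div_le_div_of_nonneg_right (w_le_mesh e.2) zero_le_two

theorem mesh_medial_le (G : WDigraph) : G.medial.mesh ≤ G.mesh / 2 :=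
  mesh_le (fun _ _ => medial_w_le) (div_nonneg G.mesh_nonneg zero_le_two)

theorem mesh_iteratedMedial_le (G : WDigraph) : ∀ n : ℕ, (G.iteratedMedial n).mesh ≤ G.mesh / 2 ^ n
  | 0 => by rw [pow_zero, div_one, iteratedMedial]
  | n + 1 => by
    have hn := G.mesh_iteratedMedial_le n
    rw [pow_succ, ← div_div]
    exact (mesh_medial_le _).trans (div_le_div_of_nonneg_right hn zero_le_two)

/-- The map of vertices that collapses the second half of every edge. -/
def collapse : G.medial.V → G.V := Sum.elim id fun e => e.1.2

/-- The distance in the medial subdivision from a vertex to its image under `collapse`. -/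
def lag : G.medial.V → ℝ := Sum.elim (fun _ => 0) fun e => G.w e.1.1 e.1.2 / 2

@[simp]
theorem collapse_ofVertex (a : G.V) : collapse (ofVertex a) = a := rfl

@[simp]
theorem collapse_midpoint (e : G.Edge) : collapse (midpoint e) = e.1.2 := rfl

theorem lag_ofVertex (a : G.V) : lag (ofVertex a) = 0 := rfl

theorem lag_midpoint (e : G.Edge) : lag (midpoint e) = G.w e.1.1 e.1.2 / 2 := rfl

theorem lag_nonneg : ∀ x : G.medial.V, 0 ≤ lag x
  | .inl _ => le_rfl
  | .inr e => (half_pos (G.w_pos _ _ e.2)).le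

theorem lag_le_mesh : ∀ x : G.medial.V, lag x ≤ G.mesh
  | .inl _ => G.mesh_nonneg
  | .inr e => (half_le_self (G.w_pos _ _ e.2).le).trans (w_le_mesh e.2)

theorem Walk.map_ofVertex {a b : G.V} {r : ℝ} (h : G.Walk a b r) :
    G.medial.Walk (ofVertex a) (ofVertex b) r := by
  induction h with
  | refl a => exact Walk.refl _
  | @cons a c b r hac _ ih =>
    have hwalk := Walk.cons (adj_ofVertex_midpoint ⟨(a, c), hac⟩)
      (Walk.cons (adj_midpoint_ofVertex ⟨(a, c), hac⟩) ih)
    rwa [w_ofVertex_midpoint, w_midpoint_ofVertex, ← add_assoc, add_halves] at hwalk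

theorem Walk.map_collapse {x y : G.medial.V} {r : ℝ} (h : G.medial.Walk x y r) :
    G.Walk (collapse x) (collapse y) (r + lag y - lag x) := by
  induction h with
  | refl x =>
    rw [zero_add, sub_self]
    exact Walk.refl _
  | @cons x z y r hxz _ ih =>
    obtain ⟨e, ⟨rfl, rfl⟩ | ⟨rfl, rfl⟩⟩ := exists_of_medial_adj hxz
    · have hlength : G.medial.w (ofVertex e.1.1) (midpoint e) + r + lag y -
          lag (ofVertex e.1.1) = G.w e.1.1 e.1.2 + (r + lag y - lag (midpoint e)) := by
        rw [w_ofVertex_midpoint, lag_ofVertex, lag_midpoint]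
        ring
      exact hlength ▸ Walk.cons e.2 ih
    · have hlength : G.medial.w (midpoint e) (ofVertex e.1.2) + r + lag y -
          lag (midpoint e) = r + lag y - lag (ofVertex e.1.2) := by
        rw [w_midpoint_ofVertex, lag_ofVertex, lag_midpoint]
        ring
      exact hlength ▸ ih

theorem shortestPath_adj_ofVertex {t : ℝ} {a b : G.V} (h : (G.shortestPath t).Adj a b) :
    (G.medial.shortestPath t).Adj (ofVertex a) (ofVertex b) := by
  obtain ⟨hab, r, hr, hrt⟩ := shortestPath_adj.1 h
  exact shortestPath_adj.2 ⟨Sum.inl_injective.ne hab, r, hr.map_ofVertex, hrt⟩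

theorem isWeakMap_ofVertex (t : ℝ) :
    IsWeakMap (G.shortestPath t) (G.medial.shortestPath t) ofVertex :=
  fun _ _ hab => Or.inr (shortestPath_adj_ofVertex hab)

theorem isWeakMap_collapse_graph : IsWeakMap G.medial.graph G.graph collapse := by
  intro x y hxy
  obtain ⟨e, ⟨rfl, rfl⟩ | ⟨rfl, rfl⟩⟩ := exists_of_medial_adj hxy
  · exact Or.inr e.2
  · exact Or.inl rfl

theorem isWeakMap_collapse_shortestPath (t : ℝ) :
    IsWeakMap (G.medial.shortestPath t) (G.shortestPath (t + G.mesh)) collapse := by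
  intro x y hxy
  obtain ⟨-, r, hr, hrt⟩ := shortestPath_adj.1 hxy
  refine or_iff_not_imp_left.2 fun hne => shortestPath_adj.2 ⟨hne, _, hr.map_collapse, ?_⟩
  linarith [lag_le_mesh y, lag_nonneg x]

open scoped Classical in
/-- The subdivision of `1`-chains: every edge of `G` is mapped to the sum of its halves. Pairs of
vertices that are not edges are mapped to `0`. -/
def subdivide : Chains G.V 1 →ₗ[ℝ] Chains G.medial.V 1 :=
  Finsupp.linearCombination ℝ fun v =>
    if h : G.graph.Adj (v 0) (v 1) then
      edge (ofVertex (v 0)) (midpoint ⟨(v 0, v 1), h⟩) +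
        edge (midpoint ⟨(v 0, v 1), h⟩) (ofVertex (v 1))
    else 0

theorem subdivide_edge (e : G.Edge) :
    subdivide (edge e.1.1 e.1.2) =
      edge (ofVertex e.1.1) (midpoint e) + edge (midpoint e) (ofVertex e.1.2) := by
  have hadj : G.graph.Adj (![e.1.1, e.1.2] 0) (![e.1.1, e.1.2] 1) := e.2
  rw [edge, regularPath_of_isRegular (isRegular_one.2 (ne_of_adj hadj)), subdivide,
    Finsupp.linearCombination_single, one_smul, dif_pos hadj]
  rfl

theorem subdivide_mem_allowed {x : Chains G.V 1} (hx : x ∈ allowed G.graph 1) :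
    subdivide x ∈ allowed G.medial.graph 1 := by
  suffices allowed G.graph 1 ≤ (allowed G.medial.graph 1).comap subdivide from this hx
  refine allowed_one_le G.loopless fun a b hab => ?_
  rw [Submodule.mem_comap, subdivide_edge ⟨(a, b), hab⟩]
  exact add_mem (edge_mem_allowed (adj_ofVertex_midpoint _))
    (edge_mem_allowed (adj_midpoint_ofVertex _))

theorem boundary_subdivide {x : Chains G.V 1} (hx : x ∈ allowed G.graph 1) :
    boundary G.medial.V 0 (subdivide x) = push ofVertex 0 (boundary G.V 0 x) := by
  suffices allowed G.graph 1 ≤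
      LinearMap.eqLocus (boundary G.medial.V 0 ∘ₗ subdivide) (push ofVertex 0 ∘ₗ boundary G.V 0)
    from this hx
  refine allowed_one_le G.loopless fun a b hab => ?_
  simp only [LinearMap.mem_eqLocus, LinearMap.comp_apply, subdivide_edge ⟨(a, b), hab⟩, map_add,
    boundary_zero_edge, map_sub, push_vertex]
  abel

theorem subdivide_mem_cycles {x : Chains G.V 1} (hx : x ∈ cycles G.graph) :
    subdivide x ∈ cycles G.medial.graph := by
  rw [mem_cycles] at hx ⊢
  exact ⟨subdivide_mem_allowed hx.1, by rw [boundary_subdivide hx.1, hx.2, map_zero]⟩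

theorem push_collapse_subdivide {x : Chains G.V 1} (hx : x ∈ allowed G.graph 1) :
    push collapse 1 (subdivide x) = x := by
  suffices allowed G.graph 1 ≤ LinearMap.eqLocus (push collapse 1 ∘ₗ subdivide) LinearMap.id
    from this hx
  refine allowed_one_le G.loopless fun a b hab => ?_
  simp [LinearMap.mem_eqLocus, subdivide_edge ⟨(a, b), hab⟩]

/-- The chain homotopy from the identity to `subdivide ∘ collapse`: it maps the midpoint of an edge
to the second half of the edge. -/
def halfEdge : Chains G.medial.V 0 →ₗ[ℝ] Chains G.medial.V 1 :=
  Finsupp.linearCombination ℝ fun v =>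
    Sum.elim (fun _ => 0) (fun e : G.Edge => edge (midpoint e) (ofVertex e.1.2)) (v 0)

theorem halfEdge_ofVertex (a : G.V) : halfEdge (vertex (ofVertex a)) = 0 := by
  simp [halfEdge, vertex, regularPath, IsRegular, ofVertex]

theorem halfEdge_midpoint (e : G.Edge) :
    halfEdge (vertex (midpoint e)) = edge (midpoint e) (ofVertex e.1.2) := by
  simp [halfEdge, vertex, regularPath, IsRegular, midpoint]

theorem subdivide_push_collapse {x : Chains G.medial.V 1} (hx : x ∈ allowed G.medial.graph 1) :
    subdivide (push collapse 1 x) = x + halfEdge (boundary G.medial.V 0 x) := by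
  suffices allowed G.medial.graph 1 ≤ LinearMap.eqLocus (subdivide ∘ₗ push collapse 1)
      (LinearMap.id + halfEdge ∘ₗ boundary G.medial.V 0) from this hx
  refine allowed_one_le G.medial.loopless fun x y hxy => ?_
  simp only [LinearMap.mem_eqLocus, LinearMap.comp_apply, LinearMap.add_apply, LinearMap.id_apply,
    boundary_zero_edge, map_sub, push_edge]
  obtain ⟨e, ⟨rfl, rfl⟩ | ⟨rfl, rfl⟩⟩ := exists_of_medial_adj hxy
  · rw [halfEdge_ofVertex, halfEdge_midpoint, collapse_ofVertex, collapse_midpoint, subdivide_edge,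
      sub_zero]
  · rw [halfEdge_ofVertex, halfEdge_midpoint, collapse_ofVertex, collapse_midpoint, edge_self,
      map_zero, zero_sub, add_neg_cancel]

theorem map_subdivide_cycles : (cycles G.graph).map subdivide = cycles G.medial.graph := by
  refine le_antisymm (Submodule.map_le_iff_le_comap.2 fun _ => subdivide_mem_cycles)
    fun x hx => ⟨_, isWeakMap_collapse_graph.push_mem_cycles hx, ?_⟩
  obtain ⟨hx_allowed, hx_closed⟩ := mem_cycles.1 hx
  rw [subdivide_push_collapse hx_allowed, hx_closed, map_zero, add_zero]

theorem map_push_collapse_cycles :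
    (cycles G.medial.graph).map (push collapse 1) = cycles G.graph :=
  le_antisymm (Submodule.map_le_iff_le_comap.2 fun _ => isWeakMap_collapse_graph.push_mem_cycles)
    fun _ hx => ⟨_, subdivide_mem_cycles hx, push_collapse_subdivide (mem_cycles.1 hx).1⟩

theorem subdivide_sub_push_mem_boundaries {t : ℝ} (ht : G.mesh ≤ t) {x : Chains G.V 1}
    (hx : x ∈ allowed G.graph 1) :
    subdivide x - push ofVertex 1 x ∈ boundaries (G.medial.shortestPath t) := by
  suffices allowed G.graph 1 ≤
      (boundaries (G.medial.shortestPath t)).comap (subdivide - push ofVertex 1) from this hx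
  have ht' : G.medial.mesh ≤ t := G.mesh_medial_le.trans ((half_le_self G.mesh_nonneg).trans ht)
  refine allowed_one_le G.loopless fun a b hab => ?_
  rw [Submodule.mem_comap, LinearMap.sub_apply, subdivide_edge ⟨(a, b), hab⟩, push_edge]
  convert triangle_mem_boundaries
    (graph_le_shortestPath ht' (adj_ofVertex_midpoint ⟨(a, b), hab⟩))
    (graph_le_shortestPath ht' (adj_midpoint_ofVertex ⟨(a, b), hab⟩))
    (shortestPath_adj_ofVertex (graph_le_shortestPath ht hab)) using 1
  abel

theorem subdivide_mem_boundaries {t : ℝ} (ht : G.mesh ≤ t) {x : Chains G.V 1}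
    (hx : x ∈ allowed G.graph 1) (hx' : x ∈ boundaries (G.shortestPath t)) :
    subdivide x ∈ boundaries (G.medial.shortestPath t) := by
  simpa using add_mem (subdivide_sub_push_mem_boundaries ht hx)
    ((isWeakMap_ofVertex t).push_mem_boundaries hx')

end Medial

variable (G : WDigraph)

theorem survivingRank_add_mesh_le (t : ℝ) :
    G.survivingRank (t + G.mesh) ≤ G.medial.survivingRank t := by
  rw [survivingRank, ← map_push_collapse_cycles]
  exact quotientRank_map_le _ fun _ _ =>
    (isWeakMap_collapse_shortestPath t).push_mem_boundaries

theorem survivingRank_medial_add_mesh_le (t : ℝ) :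
    G.medial.survivingRank (t + G.mesh) ≤ G.survivingRank t := by
  rw [survivingRank, ← map_subdivide_cycles]
  refine quotientRank_map_le _ fun x hx hx' => ?_
  rcases lt_or_ge t 0 with ht | ht
  · have hcycles : cycles (G.shortestPath t) = ⊥ :=
      cycles_eq_bot fun _ _ hab => ht.not_ge (nonneg_of_shortestPath_adj hab)
    have hx0 : x = 0 := (Submodule.mem_bot ℝ).1 (hcycles ▸ boundaries_le_cycles _ hx')
    rw [hx0, map_zero]
    exact zero_mem _
  · exact subdivide_mem_boundaries (le_add_of_nonneg_left ht) (mem_cycles.1 hx).1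
      (boundaries_mono (G.shortestPath_mono (le_add_of_nonneg_right G.mesh_nonneg)) hx')

theorem interleaved_survivingRank : Interleaved G.mesh G.survivingRank G.medial.survivingRank :=
  fun t => ⟨G.survivingRank_add_mesh_le t, G.survivingRank_medial_add_mesh_le t⟩

end WDigraph

/-! ### Pipelines that agree with the shortest-path filtration past the mesh -/

theorem surjective_subquotient_map {E : Type} [AddCommGroup E] [Module ℝ E]
    {Z B : ℝ → Submodule ℝ E} (hZ : Monotone Z) (hB : Monotone B) {s t : ℝ} (hst : s ≤ t)
    (h : Z t ≤ Z s ⊔ B t) :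
    Function.Surjective ((subquotient Z B hZ hB).map (homOfLE hst)).hom := by
  intro x
  obtain ⟨⟨x, hx⟩, rfl⟩ := Submodule.Quotient.mk_surjective _ x
  obtain ⟨y, hy, z, hz, rfl⟩ := Submodule.mem_sup.1 (h hx)
  refine ⟨Submodule.Quotient.mk ⟨y, hy⟩, (Submodule.Quotient.eq _).2 ?_⟩
  change y - (y + z) ∈ B t
  rw [sub_add_cancel_left]
  exact neg_mem hz

namespace WDigraph

/-- A filtration `K` of digraphs whose one-cycles may replace those of the shortest-path filtration:
it is empty at negative times and agrees with the shortest-path filtration from the mesh of `G` on.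
The standard and the grounded pipeline are the two examples of interest. -/
structure IsPipeline (G : WDigraph) (K : ℝ → Digraph G.V) : Prop where
  monotone : Monotone K
  nonneg_of_adj {t : ℝ} {a b : G.V} : (K t).Adj a b → 0 ≤ t
  eq_shortestPath {t : ℝ} : G.mesh ≤ t → K t = G.shortestPath t

theorem isPipeline_shortestPath (G : WDigraph) : G.IsPipeline G.shortestPath where
  monotone := G.shortestPath_mono
  nonneg_of_adj := nonneg_of_shortestPath_adj
  eq_shortestPath _ := rfl

theorem isPipeline_grounded (G : WDigraph) : G.IsPipeline G.grounded where
  monotone := G.grounded_mono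
  nonneg_of_adj hab := hab.elim And.left nonneg_of_shortestPath_adj
  eq_shortestPath ht := le_antisymm
    (fun _ _ hab => hab.elim (fun h => graph_le_shortestPath ht h.2) id) fun _ _ => Or.inr

namespace IsPipeline

variable {G : WDigraph} {K : ℝ → Digraph G.V} {C : Barcode} {s t T : ℝ}

theorem exists_isBarcode (hK : G.IsPipeline K) :
    ∃ C, IsBarcode (persistentH1 G.shortestPath K G.shortestPath_mono hK.monotone) C :=
  exists_isBarcode_subquotient _ _

theorem surjective_map (hK : G.IsPipeline K) (hs : G.mesh ≤ s) (hst : s ≤ t) :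
    Function.Surjective ((persistentH1 G.shortestPath K G.shortestPath_mono hK.monotone).map
      (homOfLE hst)).hom := by
  refine surjective_subquotient_map _ _ hst ?_
  rw [hK.eq_shortestPath hs, hK.eq_shortestPath (hs.trans hst), cycles_shortestPath (hs.trans hst)]
  exact sup_le_sup_right (cycles_mono (graph_le_shortestPath hs)) _

variable (hK : G.IsPipeline K)
  (hC : IsBarcode (persistentH1 G.shortestPath K G.shortestPath_mono hK.monotone) C)

include hC

theorem bettiCurve_eq_quotientRank (t : ℝ) :
    C.bettiCurve t = quotientRank (cycles (K t)) (boundaries (G.shortestPath t)) :=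
  (hC.finrank_eq t).symm

theorem bettiCurve_eq_survivingRank (ht : G.mesh ≤ t) :
    C.bettiCurve t = G.survivingRank t := by
  rw [hK.bettiCurve_eq_quotientRank hC, hK.eq_shortestPath ht, quotientRank_shortestPath ht]

theorem nonneg_of_mem {i : C.ι} (ht : t ∈ (C.bar i).carrier) : 0 ≤ t := by
  by_contra! hneg
  have hcycles : cycles (K t) = ⊥ :=
    cycles_eq_bot fun _ _ hab => hneg.not_ge (hK.nonneg_of_adj hab)
  have hbetti : C.bettiCurve t = 0 := by
    rw [hK.bettiCurve_eq_quotientRank hC, hcycles, quotientRank_bot]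
  exact ((Set.ncard_eq_zero).1 hbetti).le ht

theorem isBornBefore (hT : G.mesh ≤ T) : C.IsBornBefore T := fun _ _ ht =>
  ⟨hK.nonneg_of_mem hC ht, fun hTt => hC.mem_of_surjective hTt (hK.surjective_map hT hTt) ht⟩

theorem bottleneckDist_ofAntitone_le {g : ℝ → ℕ} (hg : Antitone g) {δ : ℝ} (hδ : G.mesh ≤ δ)
    (hGg : Interleaved δ G.survivingRank g) :
    bottleneckDist C (Barcode.ofAntitone hg) ≤ ENNReal.ofReal (δ + δ) := by
  have hδ0 : 0 ≤ δ := G.mesh_nonneg.trans hδ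
  refine Barcode.bottleneckDist_le_of_bettiCurve_le hδ0 (hK.isBornBefore hC hδ)
    (Barcode.isBornBefore_ofAntitone hg hδ0) (fun t ht => ?_) fun t ht => ?_
  · rw [hK.bettiCurve_eq_survivingRank hC (by linarith),
      Barcode.bettiCurve_ofAntitone hg (hδ0.trans ht)]
    exact (hGg t).1
  · rw [hK.bettiCurve_eq_survivingRank hC (hδ.trans ht),
      Barcode.bettiCurve_ofAntitone hg (by linarith)]
    exact (hGg t).2

end IsPipeline

end WDigraph

/-! ### The limit barcode -/

theorem BarcodesTendsto.of_bottleneckDist_le {M : ℕ → PersVec} {L : Barcode} {ε : ℕ → ℝ}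
    (hM : ∀ n, ∃ C, IsBarcode (M n) C)
    (hML : ∀ n C, IsBarcode (M n) C → bottleneckDist C L ≤ ENNReal.ofReal (ε n))
    (hε : Tendsto ε atTop (𝓝 0)) : BarcodesTendsto M L := by
  refine ⟨hM, fun B hB => ?_⟩
  have hofReal : Tendsto (fun n => ENNReal.ofReal (ε n)) atTop (𝓝 0) := by
    simpa only [ENNReal.ofReal_zero] using ENNReal.tendsto_ofReal hε
  exact tendsto_of_tendsto_of_tendsto_of_le_of_le tendsto_const_nhds hofReal
    (fun _ => zero_le) fun n => hML n _ (hB n)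

namespace WDigraph

variable (G : WDigraph)

/-- Twice the mesh bound for the `n`-th subdivision: as a geometric series, the sum of the mesh
bounds for all subdivisions from the `n`-th on. -/
def tailMesh (n : ℕ) : ℝ := 2 * (G.mesh / 2 ^ n)

theorem tailMesh_sub_tailMesh_succ (n : ℕ) :
    G.tailMesh n - G.tailMesh (n + 1) = G.mesh / 2 ^ n := by
  rw [tailMesh, tailMesh, pow_succ]
  ring

theorem mesh_iteratedMedial_le_tailMesh (n : ℕ) : (G.iteratedMedial n).mesh ≤ G.tailMesh n := by
  have hmesh := G.mesh_iteratedMedial_le n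
  have hnonneg := (G.iteratedMedial n).mesh_nonneg
  rw [tailMesh]
  linarith

theorem tendsto_tailMesh : Tendsto G.tailMesh atTop (𝓝 0) := by
  have h : Tendsto (fun n : ℕ => G.mesh / 2 ^ n) atTop (𝓝 0) :=
    tendsto_const_nhds.div_atTop (tendsto_pow_atTop_atTop_of_one_lt one_lt_two)
  exact mul_zero (2 : ℝ) ▸ h.const_mul 2

theorem exists_interleaved_survivingRank_iteratedMedial :
    ∃ g, Antitone g ∧ ∀ n, Interleaved (G.tailMesh n) (G.iteratedMedial n).survivingRank g := by
  refine exists_antitone_interleaved (fun n => (G.iteratedMedial n).survivingRank_antitone)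
    (fun n => (mesh_nonneg _).trans (G.mesh_iteratedMedial_le_tailMesh n)) fun n => ?_
  refine (G.iteratedMedial n).interleaved_survivingRank.mono (survivingRank_antitone _)
    (survivingRank_antitone _) ?_
  rw [tailMesh_sub_tailMesh_succ]
  exact G.mesh_iteratedMedial_le n

theorem exists_barcodesTendsto_of_isPipeline :
    ∃ L, ∀ (K : ∀ n, ℝ → Digraph (G.iteratedMedial n).V)
      (hK : ∀ n, (G.iteratedMedial n).IsPipeline (K n)),
      BarcodesTendsto (fun n => persistentH1 (G.iteratedMedial n).shortestPath (K n)
        (G.iteratedMedial n).shortestPath_mono (hK n).monotone) L := by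
  obtain ⟨g, hg, hGg⟩ := G.exists_interleaved_survivingRank_iteratedMedial
  refine ⟨Barcode.ofAntitone hg, fun K hK =>
    .of_bottleneckDist_le (fun n => (hK n).exists_isBarcode) (fun n C hC =>
      (hK n).bottleneckDist_ofAntitone_le hC hg (G.mesh_iteratedMedial_le_tailMesh n) (hGg n)) ?_⟩
  simpa only [add_zero] using G.tendsto_tailMesh.add G.tendsto_tailMesh

end WDigraph

end

end GrPPH

theorem mainTheorem11 (G : GrPPH.WDigraph) :
    ∃ L : GrPPH.Barcode,
      GrPPH.BarcodesTendsto (fun n => GrPPH.groundedPH (G.iteratedMedial n)) L ∧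
      GrPPH.BarcodesTendsto (fun n => GrPPH.standardPH (G.iteratedMedial n)) L := by
  obtain ⟨L, hL⟩ := G.exists_barcodesTendsto_of_isPipeline
  exact ⟨L, hL _ fun n => (G.iteratedMedial n).isPipeline_grounded,
    hL _ fun n => (G.iteratedMedial n).isPipeline_shortestPath⟩
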